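/- **Proposition.** Let $k$ be a field and let $(H,\mathcal R,\nu)$ be a ribbon quantum groupoid over $k$: a finite-dimensional $k$-vector space $H$ that is an algebra and a coalgebra $(\Delta,\varepsilon)$ with $\Delta$ multiplicative, $(\Delta\otimes\mathrm{id})\Delta(1)=(\Delta(1)\otimes1)(1\otimes\Delta(1))=(1\otimes\Delta(1))(\Delta(1)\otimes1)$, $\varepsilon(fgh)=\varepsilon(fg_{(1)})\varepsilon(g_{(2)}h)=\varepsilon(fg_{(2)})\varepsilon(g_{(1)}h)$, and an antipode $S$ (an anti-homomorphism of algebras and coalgebras with $h_{(1)}S(h_{(2)})=(\varepsilon\otimes\mathrm{id})(\Delta(1)(h\otimes1))=:\varepsilon_t(h)$ and $S(h_{(1)})h_{(2)}=(\mathrm{id}\otimes\varepsilon)((1\otimes h)\Delta(1))$); an element $\mathcal R\in\Delta^{op}(1)(H\otimes H)\Delta(1)$ with $\Delta^{op}(h)\mathcal R=\mathcal R\Delta(h)$, $(\mathrm{id}\otimes\Delta)\mathcal R=\mathcal R_{13}\mathcal R_{12}$, $(\Delta\otimes\mathrm{id})\mathcal R=\mathcal R_{13}\mathcal R_{23}$,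 for which some $\bar{\mathcal R}\in\Delta(1)(H\otimes H)\Delta^{op}(1)$ satisfies $\mathcal R\bar{\mathcal R}=\Delta^{op}(1)$, $\bar{\mathcal R}\mathcal R=\Delta(1)$; and an invertible central $\nu\in H$ with $\Delta(\nu)=\mathcal R_{21}\mathcal R(\nu\otimes\nu)$, $S(\nu)=\nu$. Let $\mathrm{Rep}(H)$ be the ribbon category of finite-dimensional left $H$-modules: $V\otimes W=\{x\in V\otimes_kW: x=\Delta(1)x\}$ with $H$ acting through $\Delta$; the unit object is $H_t=\varepsilon_t(H)$ with $h\cdot z=\varepsilon_t(hz)$; the associativity isomorphisms are the usual ones, and the unit isomorphisms $H_t\otimes V\to V$ and $V\otimes H_t\to V$ are the inverses of $v\mapsto 1_{(1)}\cdot 1\otimes 1_{(2)}v$ and $v\mapsto 1_{(1)}v\otimes1_{(2)}$, where $1_{(1)}\cdot1=\varepsilon_t(1_{(1)})$; $V^*=\mathrm{Hom}_k(V,k)$ with $(h\varphi)(v)=\varphi(S(h)v)$, evaluation $d_V(\varphi\otimes v)=\varphi(1_{(1)}v)1_{(2)}$ and coevaluation $b_V(z)=z\cdot\sum_if_i\otimes\xi^i$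 for dual bases $(f_i)$, $(\xi^i)$ of $V$, $V^*$; the braiding is $c_{V,W}(x)=\mathcal R^{(2)}x^{(2)}\otimes\mathcal R^{(1)}x^{(1)}$ and the twist is $\theta_V(v)=\nu v$. In a ribbon category whose Hom-sets are $k$-vector spaces, with bilinear composition and tensor product, write $\mathrm{tr}_q(f)=d_X\,c_{X,X^*}\,(\theta_Xf\otimes\mathrm{id})\,b_X\in\mathrm{End}(\mathbf 1)$ for $f\in\mathrm{End}(X)$. An object $X$ is *simple* if $k\to\mathrm{End}(X)$, $c\mapsto c\,\mathrm{id}_X$, is bijective; it is *negligible* if $\mathrm{tr}_q(f)=0$ for all $f\in\mathrm{End}(X)$; a morphism $f:X\to Y$ is *negligible* if $\mathrm{tr}_q(fg)=0$ for all $g:Y\to X$. A family $\{V_i\}_{i\in I}$ of objects *dominates* (*quasidominates*) $X$ if there are finitely many morphisms $f_r:V_{i(r)}\to X$, $g_r:X\to V_{i(r)}$ such that $\mathrm{id}_X-\sum_rf_rg_r$ is zero (negligible). Consider the following conditions on a finite family $\{V_i\}_{i\in I}$ of simple objects: 1. $V_0=\mathbf 1$ for some $0\in I$; 2. for every $i\in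 I$ there is $i^*\in I$ with $V_{i^*}\cong V_i^*$; 3. the square matrix with entries $S_{ij}=\mathrm{tr}_q(c_{V_i,V_j}\circ c_{V_j,V_i})\in\mathrm{End}(\mathbf 1)=k$ $(i,j\in I)$ is invertible over $k$. The category together with $\{V_i\}_{i\in I}$ is *modular* (*quasimodular*) if 1, 2, 3 hold and every object is dominated (quasidominated) by $\{V_i\}_{i\in I}$. The *purification* of the category has the same objects, and its morphisms are the morphisms modulo negligible ones, with the induced structure. Now let $\{V_i\}_{i\in I}$ be a finite family of finite-dimensional $H$-modules. Call $(H,\mathcal R,\nu,\{V_i\})$ a *modular quantum groupoid* if the $V_i$ are simple objects of $\mathrm{Rep}(H)$, 1, 2, 3 hold in $\mathrm{Rep}(H)$, and for all $a,b\in I$ the module $V_a\otimes V_b$ is isomorphic to the direct sum of a finite direct sum of modules $V_i$ (possibly with multiplicities) and a negligible module. Let $\mathcal C$ be the full subcategory of $\mathrm{Rep}(H)$ of the modules quasidominated by $\{V_i\}$, with the operations of $\mathrm{Rep}(H)$. Then: (a) If $(H,\mathcal R,\nu,\{V_i\})$ is a modular quantum groupoid, then $\mathcal C$ contains the unit object,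 is closed under $\otimes$ and duals (so that it is a ribbon category with the operations of $\mathrm{Rep}(H)$), and $(\mathcal C,\{V_i\})$ is quasimodular. (b) Conversely, if $\mathcal C$ contains the unit object, is closed under $\otimes$ and duals, and $(\mathcal C,\{V_i\})$ is quasimodular, then $(H,\mathcal R,\nu,\{V_i\})$ is a modular quantum groupoid. (c) In that case the purification of $\mathcal C$, together with $\{V_i\}$, is a modular category. -/

import Mathlib

open CategoryTheory MonoidalCategory
open scoped TensorProduct

universe u

/-- A (finite) quantum groupoid (weak Hopf algebra) over a field `k`. -/
class QuantumGroupoid (k H : Type u) [Field k] [Ring H] [Algebra k H] extends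
    Coalgebra k H where
  finite : Module.Finite k H
  comul_mul : ∀ a b : H, comul (a * b) = comul a * comul b
  /-- `(Δ ⊗ id)Δ(1) = (Δ(1) ⊗ 1)(1 ⊗ Δ(1))` -/
  comul_comul_one : comul.rTensor H (comul 1) =
    (comul 1 ⊗ₜ[k] (1 : H)) * (TensorProduct.assoc k H H H).symm ((1 : H) ⊗ₜ[k] comul 1)
  /-- `(Δ ⊗ id)Δ(1) = (1 ⊗ Δ(1))(Δ(1) ⊗ 1)` -/
  comul_comul_one' : comul.rTensor H (comul 1) =
    (TensorProduct.assoc k H H H).symm ((1 : H) ⊗ₜ[k] comul 1) * (comul 1 ⊗ₜ[k] (1 : H))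
  /-- `ε(fgh) = ε(f g₍₁₎) ε(g₍₂₎ h)` -/
  counit_mul_mul : ∀ f g h : H, counit (f * g * h) =
    LinearMap.mul' k k (TensorProduct.map (counit ∘ₗ LinearMap.mulLeft k f)
      (counit ∘ₗ LinearMap.mulRight k h) (comul g))
  /-- `ε(fgh) = ε(f g₍₂₎) ε(g₍₁₎ h)` -/
  counit_mul_mul' : ∀ f g h : H, counit (f * g * h) =
    LinearMap.mul' k k (TensorProduct.map (counit ∘ₗ LinearMap.mulRight k h)
      (counit ∘ₗ LinearMap.mulLeft k f) (comul g))
  /-- the antipode `S`, an anti-homomorphism of algebras and of coalgebras -/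
  antipode : H →ₗ[k] H
  antipode_one : antipode 1 = 1
  antipode_mul : ∀ a b : H, antipode (a * b) = antipode b * antipode a
  counit_antipode : ∀ a : H, counit (antipode a) = counit a
  comul_antipode : ∀ a : H, comul (antipode a) =
    TensorProduct.comm k H H (TensorProduct.map antipode antipode (comul a))
  /-- `m(id ⊗ S)Δ(h) = (ε ⊗ id)(Δ(1)(h ⊗ 1))` -/
  mul_lTensor_antipode : ∀ h : H, LinearMap.mul' k H (antipode.lTensor H (comul h)) =
    TensorProduct.lid k H (counit.rTensor H (comul 1 * (h ⊗ₜ[k] (1 : H))))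
  /-- `m(S ⊗ id)Δ(h) = (id ⊗ ε)((1 ⊗ h)Δ(1))` -/
  mul_rTensor_antipode : ∀ h : H, LinearMap.mul' k H (antipode.rTensor H (comul h)) =
    TensorProduct.rid k H (counit.lTensor H (((1 : H) ⊗ₜ[k] h) * comul 1))

namespace QuantumGroupoid

section Basic

variable (k : Type u) {H : Type u} [Field k] [Ring H] [Algebra k H] [QuantumGroupoid k H]

/-- comultiplication -/
noncomputable abbrev Δ : H →ₗ[k] H ⊗[k] H := CoalgebraStruct.comul

/-- counit -/
noncomputable abbrev ε : H →ₗ[k] k := CoalgebraStruct.counit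

/-- antipode -/
noncomputable abbrev S : H →ₗ[k] H := QuantumGroupoid.antipode

/-- the opposite comultiplication -/
noncomputable def Δop : H →ₗ[k] H ⊗[k] H := (TensorProduct.comm k H H).toLinearMap ∘ₗ Δ k

/-- the target counital map `ε_t(h) = h₍₁₎ S(h₍₂₎)` -/
noncomputable def εt : H →ₗ[k] H :=
  LinearMap.mul' k H ∘ₗ (S k).lTensor H ∘ₗ Δ k

end Basic

end QuantumGroupoid

open QuantumGroupoid in
/-- A quasitriangular quantum groupoid `(H, R)`. -/
class QuasitriangularQuantumGroupoid (k H : Type u) [Field k] [Ring H] [Algebra k H] extends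
    QuantumGroupoid k H where
  R : H ⊗[k] H
  /-- `R ∈ Δᵒᵖ(1)(H ⊗ H)Δ(1)` -/
  R_mem : ∃ x : H ⊗[k] H, R = Δop k 1 * x * Δ k 1
  Δop_mul_R : ∀ h : H, Δop k h * R = R * Δ k h
  /-- `(id ⊗ Δ)R = R₁₃R₁₂` -/
  lTensor_R : (TensorProduct.assoc k H H H).symm ((Δ k).lTensor H R) =
    TensorProduct.rightComm k H H H (R ⊗ₜ[k] (1 : H)) * (R ⊗ₜ[k] (1 : H))
  /-- `(Δ ⊗ id)R = R₁₃R₂₃` -/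
  rTensor_R : (Δ k).rTensor H R =
    TensorProduct.rightComm k H H H (R ⊗ₜ[k] (1 : H)) *
      (TensorProduct.assoc k H H H).symm ((1 : H) ⊗ₜ[k] R)
  /-- there is `R' ∈ Δ(1)(H ⊗ H)Δᵒᵖ(1)` with `RR' = Δᵒᵖ(1)` and `R'R = Δ(1)` -/
  exists_R_inv : ∃ x : H ⊗[k] H, R * (Δ k 1 * x * Δop k 1) = Δop k 1 ∧
    (Δ k 1 * x * Δop k 1) * R = Δ k 1

open QuantumGroupoid in
/-- A ribbon quantum groupoid `(H, R, ν)`. -/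
class RibbonQuantumGroupoid (k H : Type u) [Field k] [Ring H] [Algebra k H] extends
    QuasitriangularQuantumGroupoid k H where
  ν : H
  isUnit_ν : IsUnit ν
  ν_central : ∀ h : H, ν * h = h * ν
  /-- `Δ(ν) = R₂₁R(ν ⊗ ν)` -/
  Δ_ν : Δ k ν = TensorProduct.comm k H H R * R * (ν ⊗ₜ[k] ν)
  S_ν : S k ν = ν

namespace QuantumGroupoid

section Lemmas

variable {k H : Type u} [Field k] [Ring H] [Algebra k H] [QuantumGroupoid k H]

lemma Δ_mul (a b : H) : Δ k (a * b) = Δ k a * Δ k b := comul_mul a b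

lemma Δ_one_mul_Δ (a : H) : Δ k (1 : H) * Δ k a = Δ k a := by rw [← Δ_mul, one_mul]

lemma Δ_mul_Δ_one (a : H) : Δ k a * Δ k (1 : H) = Δ k a := by rw [← Δ_mul, mul_one]

lemma εt_eq (h : H) : εt k h =
    TensorProduct.lid k H ((ε k).rTensor H (Δ k 1 * (h ⊗ₜ[k] (1 : H)))) :=
  mul_lTensor_antipode h

/-- The map `x ⊗ y ↦ ε(x z) y`. -/
noncomputable def ctrL (z : H) : H ⊗[k] H →ₗ[k] H :=
  (TensorProduct.lid k H).toLinearMap ∘ₗ (ε k ∘ₗ LinearMap.mulRight k z).rTensor H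

@[simp] lemma ctrL_tmul (z a b : H) : ctrL z (a ⊗ₜ[k] b) = ε k (a * z) • b := by
  simp [ctrL]

/-- The map `x ⊗ y ↦ ε(a x) y`. -/
noncomputable def ctrL' (c : H) : H ⊗[k] H →ₗ[k] H :=
  (TensorProduct.lid k H).toLinearMap ∘ₗ (ε k ∘ₗ LinearMap.mulLeft k c).rTensor H

@[simp] lemma ctrL'_tmul (z a b : H) : ctrL' z (a ⊗ₜ[k] b) = ε k (z * a) • b := by
  simp [ctrL']

/-- The map `x ⊗ y ↦ ε(y z) x`. -/
noncomputable def ctrR (z : H) : H ⊗[k] H →ₗ[k] H :=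
  (TensorProduct.rid k H).toLinearMap ∘ₗ (ε k ∘ₗ LinearMap.mulRight k z).lTensor H

@[simp] lemma ctrR_tmul (z a b : H) : ctrR z (a ⊗ₜ[k] b) = ε k (b * z) • a := by
  simp [ctrR]

/-- The map `x ⊗ y ↦ ε(a y) x`. -/
noncomputable def ctrR' (c : H) : H ⊗[k] H →ₗ[k] H :=
  (TensorProduct.rid k H).toLinearMap ∘ₗ (ε k ∘ₗ LinearMap.mulLeft k c).lTensor H

@[simp] lemma ctrR'_tmul (z a b : H) : ctrR' z (a ⊗ₜ[k] b) = ε k (z * b) • a := by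
  simp [ctrR']

lemma εt_eq_ctrL (h : H) : εt k h = ctrL h (Δ k 1) := by
  rw [εt_eq]
  induction Δ k (1 : H) using TensorProduct.induction_on with
  | zero => simp
  | tmul a b => simp
  | add x y hx hy => rw [add_mul, map_add, map_add, map_add, hx, hy]

end Lemmas
end QuantumGroupoid

namespace QuantumGroupoid
section Lemmas2

variable {k H : Type u} [Field k] [Ring H] [Algebra k H] [QuantumGroupoid k H]

lemma counit_rid (a : H) : TensorProduct.rid k H ((ε k).lTensor H (Δ k a)) = a := by
  simp [Δ, ε]

lemma counit_lid (a : H) : TensorProduct.lid k H ((ε k).rTensor H (Δ k a)) = a := by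
  simp [Δ, ε]

lemma ctrL_one (h : H) : ctrL 1 (Δ k h) = h := by
  have : (ctrL (1 : H) : H ⊗[k] H →ₗ[k] H) =
      (TensorProduct.lid k H).toLinearMap ∘ₗ (ε k).rTensor H := by ext; simp
  rw [this]; exact counit_lid h

lemma ctrL'_one (h : H) : ctrL' 1 (Δ k h) = h := by
  have : (ctrL' (1 : H) : H ⊗[k] H →ₗ[k] H) =
      (TensorProduct.lid k H).toLinearMap ∘ₗ (ε k).rTensor H := by ext; simp
  rw [this]; exact counit_lid h

lemma ctrR_one (h : H) : ctrR 1 (Δ k h) = h := by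
  have : (ctrR (1 : H) : H ⊗[k] H →ₗ[k] H) =
      (TensorProduct.rid k H).toLinearMap ∘ₗ (ε k).lTensor H := by ext; simp
  rw [this]; exact counit_rid h

lemma ctrR'_one (h : H) : ctrR' 1 (Δ k h) = h := by
  have : (ctrR' (1 : H) : H ⊗[k] H →ₗ[k] H) =
      (TensorProduct.rid k H).toLinearMap ∘ₗ (ε k).lTensor H := by ext; simp
  rw [this]; exact counit_rid h

lemma coassoc_symm (h : H) : (Δ k).rTensor H (Δ k h) =
    (TensorProduct.assoc k H H H).symm ((Δ k).lTensor H (Δ k h)) :=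
  (Coalgebra.coassoc_symm_apply h).symm

/-- `ε(h₍₁₎z) h₍₂₎ = h ε(1₍₁₎z) 1₍₂₎` -/
lemma ctrL_Δ (z h : H) : ctrL z (Δ k h) = h * ctrL z (Δ k 1) := by
  let F (s : H ⊗[k] H) : (H ⊗[k] H) ⊗[k] H →ₗ[k] H :=
    (TensorProduct.lid k H).toLinearMap ∘ₗ TensorProduct.map (ε k ∘ₗ LinearMap.mulRight k z)
      (ctrL 1 ∘ₗ LinearMap.mulLeft k s) ∘ₗ (TensorProduct.assoc k H H H).toLinearMap
  have h1 (s t : H ⊗[k] H) : ctrL z (s * t) = F s ((Δ k).rTensor H t) := by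
    induction t using TensorProduct.induction_on with
    | zero => simp
    | add x y hx hy => rw [mul_add, map_add, map_add, map_add, hx, hy]
    | tmul c d =>
      induction s using TensorProduct.induction_on with
      | zero => simp [F]
      | add x y hx hy =>
        rw [add_mul, map_add, hx, hy]
        have : F (x + y) = F x + F y := by
          ext; simp [F, add_mul]
        rw [this]; rfl
      | tmul a b =>
        simp only [Algebra.TensorProduct.tmul_mul_tmul, ctrL_tmul, LinearMap.rTensor_tmul]
        have := counit_mul_mul' (k := k) a c z
        rw [show ε k (a * c * z) = _ from this]
        change (LinearMap.mul' k k (TensorProduct.map _ _ (Δ k c))) • _ = _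
        induction Δ k c using TensorProduct.induction_on with
        | zero => simp
        | add x y hx hy =>
          rw [map_add, map_add, add_smul, hx, hy, TensorProduct.add_tmul, map_add]
        | tmul x y => simp [F, smul_smul, mul_comm]
  have h2 (t : H ⊗[k] H) : F (Δ k h) ((TensorProduct.assoc k H H H).symm ((Δ k).lTensor H t)) =
      h * ctrL z t := by
    induction t using TensorProduct.induction_on with
    | zero => simp
    | add x y hx hy => rw [map_add, map_add, map_add, map_add, mul_add, hx, hy]
    | tmul c d => simp [F, ← Δ_mul, ctrL_one]
  rw [← Δ_mul_Δ_one h, h1, coassoc_symm, h2]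

/-- `h₍₁₎ ε(h₍₂₎z) = h 1₍₁₎ ε(1₍₂₎z)` -/
lemma ctrR_Δ (z h : H) : ctrR z (Δ k h) = h * ctrR z (Δ k 1) := by
  let F (s : H ⊗[k] H) : (H ⊗[k] H) ⊗[k] H →ₗ[k] H :=
    (TensorProduct.rid k H).toLinearMap ∘ₗ TensorProduct.map 
      (ctrR 1 ∘ₗ LinearMap.mulLeft k s) (ε k ∘ₗ LinearMap.mulRight k z)
  have h1 (s t : H ⊗[k] H) : ctrR z (s * t) =
      F s ((TensorProduct.assoc k H H H).symm ((Δ k).lTensor H t)) := by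
    induction t using TensorProduct.induction_on with
    | zero => simp
    | add x y hx hy => rw [mul_add, map_add, map_add, map_add, map_add, hx, hy]
    | tmul c d =>
      induction s using TensorProduct.induction_on with
      | zero => simp [F]
      | add x y hx hy =>
        rw [add_mul, map_add, hx, hy]
        have : F (x + y) = F x + F y := by
          ext; simp [F, add_mul, TensorProduct.add_tmul]
        rw [this]; rfl
      | tmul a b =>
        simp only [Algebra.TensorProduct.tmul_mul_tmul, ctrR_tmul, LinearMap.lTensor_tmul]
        have := counit_mul_mul (k := k) b d z
        rw [show ε k (b * d * z) = _ from this]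
        change (LinearMap.mul' k k (TensorProduct.map _ _ (Δ k d))) • _ = _
        induction Δ k d using TensorProduct.induction_on with
        | zero => simp
        | add x y hx hy =>
          rw [map_add, map_add, add_smul, hx, hy, TensorProduct.tmul_add, map_add, map_add]
        | tmul x y => simp [F, smul_smul, mul_comm]
  have h2 (t : H ⊗[k] H) : F (Δ k h) ((Δ k).rTensor H t) = h * ctrR z t := by
    induction t using TensorProduct.induction_on with
    | zero => simp
    | add x y hx hy => rw [map_add, map_add, map_add, mul_add, hx, hy]
    | tmul c d => simp [F, ← Δ_mul, ctrR_one]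
  rw [← Δ_mul_Δ_one h, h1, ← coassoc_symm, h2]

/-- `ε(c h₍₁₎) h₍₂₎ = ε(c 1₍₁₎) 1₍₂₎ h` -/
lemma ctrL'_Δ (z h : H) : ctrL' z (Δ k h) = ctrL' z (Δ k 1) * h := by
  let F (s : H ⊗[k] H) : (H ⊗[k] H) ⊗[k] H →ₗ[k] H :=
    (TensorProduct.lid k H).toLinearMap ∘ₗ TensorProduct.map (ε k ∘ₗ LinearMap.mulLeft k z)
      (ctrL 1 ∘ₗ LinearMap.mulRight k s) ∘ₗ (TensorProduct.assoc k H H H).toLinearMap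
  have h1 (s t : H ⊗[k] H) : ctrL' z (t * s) = F s ((Δ k).rTensor H t) := by
    induction t using TensorProduct.induction_on with
    | zero => simp
    | add x y hx hy => rw [add_mul, map_add, map_add, map_add, hx, hy]
    | tmul c d =>
      induction s using TensorProduct.induction_on with
      | zero => simp [F]
      | add x y hx hy =>
        rw [mul_add, map_add, hx, hy]
        have : F (x + y) = F x + F y := by
          ext; simp [F, mul_add]
        rw [this]; rfl
      | tmul a b =>
        simp only [Algebra.TensorProduct.tmul_mul_tmul, ctrL'_tmul, LinearMap.rTensor_tmul]
        have := counit_mul_mul (k := k) z c a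
        rw [← mul_assoc, show ε k (z * c * a) = _ from this]
        change (LinearMap.mul' k k (TensorProduct.map _ _ (Δ k c))) • _ = _
        induction Δ k c using TensorProduct.induction_on with
        | zero => simp
        | add x y hx hy =>
          rw [map_add, map_add, add_smul, hx, hy, TensorProduct.add_tmul, map_add]
        | tmul x y => simp [F, smul_smul, mul_comm]
  have h2 (t : H ⊗[k] H) : F (Δ k h) ((TensorProduct.assoc k H H H).symm ((Δ k).lTensor H t)) =
      ctrL' z t * h := by
    induction t using TensorProduct.induction_on with
    | zero => simp
    | add x y hx hy => rw [map_add, map_add, map_add, map_add, add_mul, hx, hy]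
    | tmul c d => simp [F, ← Δ_mul, ctrL_one]
  rw [← Δ_one_mul_Δ h, h1, coassoc_symm, h2]

/-- `h₍₁₎ ε(c h₍₂₎) = 1₍₁₎ ε(c 1₍₂₎) h` -/
lemma ctrR'_Δ (z h : H) : ctrR' z (Δ k h) = ctrR' z (Δ k 1) * h := by
  let F (s : H ⊗[k] H) : (H ⊗[k] H) ⊗[k] H →ₗ[k] H :=
    (TensorProduct.rid k H).toLinearMap ∘ₗ TensorProduct.map 
      (ctrR 1 ∘ₗ LinearMap.mulRight k s) (ε k ∘ₗ LinearMap.mulLeft k z)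
  have h1 (s t : H ⊗[k] H) : ctrR' z (t * s) =
      F s ((TensorProduct.assoc k H H H).symm ((Δ k).lTensor H t)) := by
    induction t using TensorProduct.induction_on with
    | zero => simp
    | add x y hx hy => rw [add_mul, map_add, map_add, map_add, map_add, hx, hy]
    | tmul c d =>
      induction s using TensorProduct.induction_on with
      | zero => simp [F]
      | add x y hx hy =>
        rw [mul_add, map_add, hx, hy]
        have : F (x + y) = F x + F y := by
          ext; simp [F, mul_add, TensorProduct.add_tmul]
        rw [this]; rfl
      | tmul a b =>
        simp only [Algebra.TensorProduct.tmul_mul_tmul, ctrR'_tmul, LinearMap.lTensor_tmul]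
        have := counit_mul_mul' (k := k) z d b
        rw [← mul_assoc, show ε k (z * d * b) = _ from this]
        change (LinearMap.mul' k k (TensorProduct.map _ _ (Δ k d))) • _ = _
        induction Δ k d using TensorProduct.induction_on with
        | zero => simp
        | add x y hx hy =>
          rw [map_add, map_add, add_smul, hx, hy, TensorProduct.tmul_add, map_add, map_add]
        | tmul x y => simp [F, smul_smul, mul_comm]
  have h2 (t : H ⊗[k] H) : F (Δ k h) ((Δ k).rTensor H t) = ctrR' z t * h := by
    induction t using TensorProduct.induction_on with
    | zero => simp
    | add x y hx hy => rw [map_add, map_add, map_add, add_mul, hx, hy]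
    | tmul c d => simp [F, ← Δ_mul, ctrR_one]
  rw [← Δ_one_mul_Δ h, h1, ← coassoc_symm, h2]

end Lemmas2
end QuantumGroupoid

namespace QuantumGroupoid
section Lemmas3

variable {k H : Type u} [Field k] [Ring H] [Algebra k H] [QuantumGroupoid k H]

/-- `ε(g ε_t(x)) = ε(g x)` -/
lemma ε_mul_εt (g x : H) : ε k (g * εt k x) = ε k (g * x) := by
  have h := counit_mul_mul' (k := k) g 1 x
  rw [mul_one] at h
  rw [h, εt_eq_ctrL]
  induction (CoalgebraStruct.comul (1 : H) : H ⊗[k] H) using TensorProduct.induction_on with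
  | zero => simp
  | add x y hx hy => rw [map_add, map_add, mul_add, map_add, map_add, hx, hy]
  | tmul a b => simp

lemma ε_εt (x : H) : ε k (εt k x) = ε k x := by
  simpa using ε_mul_εt (k := k) 1 x

/-- `ε_t(h ε_t(x)) = ε_t(h x)` -/
lemma εt_mul_εt (h x : H) : εt k (h * εt k x) = εt k (h * x) := by
  rw [εt_eq_ctrL (h * _), εt_eq_ctrL (h * x)]
  induction (Δ k (1 : H) : H ⊗[k] H) using TensorProduct.induction_on with
  | zero => simp
  | add x y hx hy => rw [map_add, map_add, hx, hy]
  | tmul a b => simp only [ctrL_tmul, ← mul_assoc, ε_mul_εt]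

lemma εt_εt (x : H) : εt k (εt k x) = εt k x := by
  simpa using εt_mul_εt (k := k) 1 x

lemma εt_one : εt k (1 : H) = 1 := by
  rw [εt_eq_ctrL, ctrL_one]

/-- The source counital map `ε_s(h) = S(h₍₁₎)h₍₂₎`. -/
noncomputable def εs : H →ₗ[k] H :=
  LinearMap.mul' k H ∘ₗ (S k).rTensor H ∘ₗ Δ k

lemma εs_eq_ctrR' (h : H) : εs (k := k) h = ctrR' h (Δ k 1) := by
  refine (mul_rTensor_antipode h).trans ?_
  change _ = ctrR' h (CoalgebraStruct.comul (1 : H))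
  induction (CoalgebraStruct.comul (1 : H) : H ⊗[k] H) using TensorProduct.induction_on with
  | zero => simp
  | tmul a b => simp
  | add x y hx hy => rw [mul_add, map_add, map_add, map_add, hx, hy]

lemma εs_one : εs (k := k) (1 : H) = 1 := by
  rw [εs_eq_ctrR', ctrR'_one]

/-- `x ↦ ε(x t₁) t₂`, linear in `x` -/
noncomputable def cL' (s : H ⊗[k] H) : H →ₗ[k] H where
  toFun x := ctrL' x s
  map_add' x y := by
    have : (ctrL' (x + y) : H ⊗[k] H →ₗ[k] H) = ctrL' x + ctrL' y := by
      ext; simp [add_mul, add_smul]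
    rw [this]; rfl
  map_smul' c x := by
    have : (ctrL' (c • x) : H ⊗[k] H →ₗ[k] H) = c • ctrL' x := by
      ext; simp [mul_smul]
    rw [this]; rfl

/-- `x ↦ ε(x t₂) t₁`, linear in `x` -/
noncomputable def cR' (s : H ⊗[k] H) : H →ₗ[k] H where
  toFun x := ctrR' x s
  map_add' x y := by
    have : (ctrR' (x + y) : H ⊗[k] H →ₗ[k] H) = ctrR' x + ctrR' y := by
      ext; simp [add_mul, add_smul]
    rw [this]; rfl
  map_smul' c x := by
    have : (ctrR' (c • x) : H ⊗[k] H →ₗ[k] H) = c • ctrR' x := by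
      ext; simp [mul_smul]
    rw [this]; rfl

/-- `x ↦ ε(t₁ x) t₂`, linear in `x` -/
noncomputable def cL (s : H ⊗[k] H) : H →ₗ[k] H where
  toFun x := ctrL x s
  map_add' x y := by
    have : (ctrL (x + y) : H ⊗[k] H →ₗ[k] H) = ctrL x + ctrL y := by
      ext; simp [mul_add, add_smul]
    rw [this]; rfl
  map_smul' c x := by
    have : (ctrL (c • x) : H ⊗[k] H →ₗ[k] H) = c • ctrL x := by
      ext; simp [mul_smul]
    rw [this]; rfl

lemma cL_Δ_one : cL (Δ k (1 : H)) = εt k := LinearMap.ext fun x => (εt_eq_ctrL x).symm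

lemma cR'_Δ_one : cR' (Δ k (1 : H)) = εs := LinearMap.ext fun x => (εs_eq_ctrR' x).symm

lemma rTensor_cL (s t : H ⊗[k] H) : (cL t).rTensor H s =
    TensorProduct.comm k H H ((cL' s).rTensor H t) := by
  induction t using TensorProduct.induction_on with
  | zero =>
    rw [show cL (0 : H ⊗[k] H) = 0 from LinearMap.ext fun x => map_zero (ctrL (k := k) x)]; simp
  | add a b ha hb =>
    rw [show cL (a + b) = cL a + cL b from LinearMap.ext fun x => map_add (ctrL x) a b,
      LinearMap.rTensor_add, LinearMap.add_apply, ha, hb, map_add, map_add]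
  | tmul a b =>
    induction s using TensorProduct.induction_on with
    | zero => 
      rw [show cL' (0 : H ⊗[k] H) = 0 from LinearMap.ext fun x => map_zero (ctrL' (k := k) x)]; simp
    | add x y hx hy =>
      rw [show cL' (x + y) = cL' x + cL' y from LinearMap.ext fun z => map_add (ctrL' z) x y,
        LinearMap.rTensor_add, LinearMap.add_apply, map_add, hx, hy, map_add]
    | tmul x y => simp [cL, cL', TensorProduct.smul_tmul]

lemma lTensor_cL (s t : H ⊗[k] H) : (cL t).lTensor H s = (cR' s).rTensor H t := by
  induction t using TensorProduct.induction_on with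
  | zero =>
    rw [show cL (0 : H ⊗[k] H) = 0 from LinearMap.ext fun x => map_zero (ctrL (k := k) x)]; simp
  | add a b ha hb =>
    rw [show cL (a + b) = cL a + cL b from LinearMap.ext fun x => map_add (ctrL x) a b,
      LinearMap.lTensor_add, LinearMap.add_apply, ha, hb, map_add]
  | tmul a b =>
    induction s using TensorProduct.induction_on with
    | zero => 
      rw [show cR' (0 : H ⊗[k] H) = 0 from LinearMap.ext fun x => map_zero (ctrR' (k := k) x)]; simp
    | add x y hx hy =>
      rw [show cR' (x + y) = cR' x + cR' y from LinearMap.ext fun z => map_add (ctrR' z) x y,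
        LinearMap.rTensor_add, LinearMap.add_apply, map_add, hx, hy]
    | tmul x y => simp [cL, cR', TensorProduct.smul_tmul]

lemma rTensor_εt_congr {s s' : H ⊗[k] H} (h : ∀ e : H, ctrL' e s = ctrL' e s') :
    (εt k).rTensor H s = (εt k).rTensor H s' := by
  rw [← cL_Δ_one, rTensor_cL, rTensor_cL, show cL' s = cL' s' from LinearMap.ext h]

lemma lTensor_εt_congr {s s' : H ⊗[k] H} (h : ∀ e : H, ctrR' e s = ctrR' e s') :
    (εt k).lTensor H s = (εt k).lTensor H s' := by
  rw [← cL_Δ_one, lTensor_cL, lTensor_cL, show cR' s = cR' s' from LinearMap.ext h]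

/-- `ε_t(h₍₁₎) ⊗ h₍₂₎ = ε_t(1₍₁₎) ⊗ 1₍₂₎h` -/
lemma rTensor_εt_Δ (h : H) : (εt k).rTensor H (Δ k h) =
    (εt k).rTensor H (Δ k 1 * ((1 : H) ⊗ₜ[k] h)) := by
  refine rTensor_εt_congr fun e => ?_
  rw [ctrL'_Δ]
  induction (Δ k (1 : H) : H ⊗[k] H) using TensorProduct.induction_on with
  | zero => simp
  | tmul a b => simp
  | add x y hx hy => rw [add_mul, map_add, map_add, add_mul, hx, hy]

/-- `ε(e 1₍₂₎ z) 1₍₁₎ = ε(e 1₍₂₎) 1₍₁₎ 1'₍₁₎ ε(1'₍₂₎ z)` -/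
lemma ctrR'_one_mul (e z : H) : ctrR' e (Δ k 1 * ((1 : H) ⊗ₜ[k] z)) =
    ctrR' e (Δ k 1) * ctrR z (Δ k 1) := by
  let P : (H ⊗[k] H) ⊗[k] H →ₗ[k] H := (TensorProduct.rid k H).toLinearMap ∘ₗ
    TensorProduct.map (ctrR' e) (ε k ∘ₗ LinearMap.mulRight k z)
  have h1 (t : H ⊗[k] H) : ctrR' e (t * ((1 : H) ⊗ₜ[k] z)) =
      P ((TensorProduct.assoc k H H H).symm ((Δ k).lTensor H t)) := by
    induction t using TensorProduct.induction_on with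
    | zero => simp
    | add x y hx hy => rw [add_mul, map_add, map_add, map_add, map_add, hx, hy]
    | tmul a b =>
      simp only [Algebra.TensorProduct.tmul_mul_tmul, mul_one, ctrR'_tmul, LinearMap.lTensor_tmul]
      rw [← mul_assoc, show ε k (e * b * z) = _ from counit_mul_mul (k := k) e b z]
      change (LinearMap.mul' k k (TensorProduct.map _ _ (Δ k b))) • _ = _
      induction Δ k b using TensorProduct.induction_on with
      | zero => simp
      | add x y hx hy =>
        rw [map_add, map_add, add_smul, hx, hy, TensorProduct.tmul_add, map_add, map_add]
      | tmul x y => simp [P, smul_smul, mul_comm]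
  have h2 (t : H ⊗[k] H) : P ((Δ k).rTensor H t) = ctrR' e (Δ k 1) * ctrR z t := by
    induction t using TensorProduct.induction_on with
    | zero => simp
    | add x y hx hy => rw [map_add, map_add, map_add, mul_add, hx, hy]
    | tmul a b =>
      have : P ((Δ k).rTensor H (a ⊗ₜ[k] b)) = ε k (b * z) • ctrR' e (Δ k a) := by simp [P]
      rw [this, ctrR'_Δ]; simp
  rw [h1, ← coassoc_symm, h2]

/-- `1₍₁₎ ⊗ ε_t(1₍₂₎z) = 1₍₁₎1'₍₁₎ε(1'₍₂₎z) ⊗ ε_t(1₍₂₎)` -/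
lemma lTensor_εt_one_mul (z : H) : (εt k).lTensor H (Δ k 1 * ((1 : H) ⊗ₜ[k] z)) =
    (εt k).lTensor H (Δ k 1 * (ctrR z (Δ k 1) ⊗ₜ[k] (1 : H))) := by
  refine lTensor_εt_congr fun e => ?_
  rw [ctrR'_one_mul]
  generalize ctrR z (Δ k (1 : H)) = y
  induction (Δ k (1 : H) : H ⊗[k] H) using TensorProduct.induction_on with
  | zero => simp
  | tmul a b => simp
  | add u v hu hv => rw [add_mul, map_add, map_add, add_mul, hu, hv]

lemma assoc_symm_mul {k H : Type u} [Field k] [Ring H] [Algebra k H] (s t : H ⊗[k] H) (P : (H ⊗[k] H) ⊗[k] H →ₗ[k] H ⊗[k] H)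
    (Q : H ⊗[k] H →ₗ[k] H ⊗[k] H →ₗ[k] H ⊗[k] H)
    (h : ∀ a b c d : H, P ((c ⊗ₜ[k] (a * d)) ⊗ₜ[k] b) = Q (a ⊗ₜ b) (c ⊗ₜ d)) :
    P ((TensorProduct.assoc k H H H).symm ((1 : H) ⊗ₜ[k] s) * (t ⊗ₜ[k] (1 : H))) = Q s t := by
  induction s using TensorProduct.induction_on with
  | zero => simp
  | add a b ha hb =>
    rw [TensorProduct.tmul_add, map_add, add_mul, map_add, ha, hb, map_add]; rfl
  | tmul a b =>
    induction t using TensorProduct.induction_on with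
    | zero => simp
    | add x y hx hy => rw [TensorProduct.add_tmul, mul_add, map_add, hx, hy, map_add]
    | tmul x y => simp [h]

/-- `(Δ ⊗ id)Δ(1) = (1 ⊗ Δ(1))(Δ(1) ⊗ 1)` -/
lemma comul_comul_one'' : (Δ k).rTensor H (Δ k (1 : H)) =
    (TensorProduct.assoc k H H H).symm ((1 : H) ⊗ₜ[k] Δ k 1) * (Δ k 1 ⊗ₜ[k] (1 : H)) :=
  comul_comul_one'

/-- `1₍₁₎ ⊗ ε_t(1₍₂₎) = Δ(1)` -/
lemma lTensor_εt_one : (εt k).lTensor H (Δ k (1 : H)) = Δ k 1 := by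
  let P : (H ⊗[k] H) ⊗[k] H →ₗ[k] H ⊗[k] H :=
    ((TensorProduct.lid k H).toLinearMap ∘ₗ (ε k).rTensor H).lTensor H ∘ₗ
      (TensorProduct.assoc k H H H).toLinearMap
  let Q : H ⊗[k] H →ₗ[k] H ⊗[k] H →ₗ[k] H ⊗[k] H := LinearMap.lTensorHom H ∘ₗ
    { toFun := cL, map_add' := fun s t => LinearMap.ext fun x => map_add (ctrL x) s t,
      map_smul' := fun c s => LinearMap.ext fun x => map_smul (ctrL x) c s }
  have h := assoc_symm_mul (Δ k (1 : H)) (Δ k 1) P Q (by simp [P, Q, cL])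
  rw [← comul_comul_one'', coassoc_symm] at h
  have h2 : ∀ t : H ⊗[k] H, P ((TensorProduct.assoc k H H H).symm ((Δ k).lTensor H t)) = t := by
    intro t
    induction t using TensorProduct.induction_on with
    | zero => simp
    | add x y hx hy => rw [map_add, map_add, map_add, hx, hy]
    | tmul x y => simp [P]
  rw [h2] at h
  rw [← cL_Δ_one]
  exact h.symm

/-- `ε_s(1₍₁₎) ⊗ 1₍₂₎ = Δ(1)` -/
lemma rTensor_εs_one : (εs (k := k)).rTensor H (Δ k (1 : H)) = Δ k 1 := by
  let P : (H ⊗[k] H) ⊗[k] H →ₗ[k] H ⊗[k] H :=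
    ((TensorProduct.rid k H).toLinearMap ∘ₗ (ε k).lTensor H).rTensor H
  let Q : H ⊗[k] H →ₗ[k] H ⊗[k] H →ₗ[k] H ⊗[k] H := LinearMap.flip (LinearMap.rTensorHom H ∘ₗ
    { toFun := cR', map_add' := fun s t => LinearMap.ext fun x => map_add (ctrR' x) s t,
      map_smul' := fun c s => LinearMap.ext fun x => map_smul (ctrR' x) c s })
  have h := assoc_symm_mul (Δ k (1 : H)) (Δ k 1) P Q (by simp [P, Q, cR'])
  rw [← comul_comul_one''] at h
  have h2 : ∀ t : H ⊗[k] H, P ((Δ k).rTensor H t) = t := by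
    intro t
    induction t using TensorProduct.induction_on with
    | zero => simp
    | add x y hx hy => rw [map_add, map_add, hx, hy]
    | tmul x y => simp [P]
  rw [h2] at h
  rw [← cR'_Δ_one]
  exact h.symm

/-- `Δ(z) = Δ(1)(z ⊗ 1)` for `z ∈ H_t` -/
lemma Δ_εt (w : H) : Δ k (εt k w) = Δ k 1 * (εt k w ⊗ₜ[k] (1 : H)) := by
  let P : (H ⊗[k] H) ⊗[k] H →ₗ[k] H ⊗[k] H := (ctrL w).rTensor H
  have h1 (t : H ⊗[k] H) : Δ k (ctrL w t) =
      P ((TensorProduct.assoc k H H H).symm ((Δ k).lTensor H t)) := by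
    induction t using TensorProduct.induction_on with
    | zero => simp
    | add x y hx hy => rw [map_add, map_add, map_add, map_add, map_add, hx, hy]
    | tmul x y =>
      simp only [ctrL_tmul, map_smul, LinearMap.lTensor_tmul]
      induction Δ k y using TensorProduct.induction_on with
      | zero => simp
      | add x y hx hy => rw [TensorProduct.tmul_add, map_add, map_add, smul_add, hx, hy]
      | tmul x y => simp [P, TensorProduct.smul_tmul']
  let Q : H ⊗[k] H →ₗ[k] H ⊗[k] H →ₗ[k] H ⊗[k] H :=
    (LinearMap.compl₂ (LinearMap.mul k (H ⊗[k] H))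
      ((TensorProduct.mk k H H).flip (1 : H) ∘ₗ ctrL w))
  have h := assoc_symm_mul (Δ k (1 : H)) (Δ k 1) P Q (by intros; simp [P, Q, TensorProduct.smul_tmul'])
  rw [εt_eq_ctrL, h1, ← coassoc_symm, comul_comul_one'', h]
  rfl

/-- `a ⊗ b ↦ (S(a) ⊗ 1) t (b ⊗ 1)` -/
noncomputable def sandwich (t : H ⊗[k] H) : H ⊗[k] H →ₗ[k] H ⊗[k] H :=
  TensorProduct.lift (LinearMap.mk₂ k
    (fun a b => (S k a ⊗ₜ[k] (1 : H)) * t * (b ⊗ₜ[k] (1 : H)))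
    (by intros; rw [map_add, TensorProduct.add_tmul, add_mul, add_mul])
    (by intros; rw [map_smul, ← TensorProduct.smul_tmul', smul_mul_assoc, smul_mul_assoc])
    (by intros; rw [TensorProduct.add_tmul, mul_add])
    (by intros; rw [← TensorProduct.smul_tmul', mul_smul_comm]))

lemma sandwich_tmul (t : H ⊗[k] H) (a b : H) : sandwich t (a ⊗ₜ[k] b) =
    (S k a ⊗ₜ[k] (1 : H)) * t * (b ⊗ₜ[k] (1 : H)) := rfl

/-- `1₍₁₎ ⊗ ε_t(h 1₍₂₎) = S(h₍₁₎) 1₍₁₎ h₍₂₎ ⊗ 1₍₂₎` -/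
lemma lTensor_εt_mul_one (h : H) : (εt k).lTensor H (((1 : H) ⊗ₜ[k] h) * Δ k 1) =
    sandwich (Δ k 1) (Δ k h) := by
  have e1 : (εt k).lTensor H (((1 : H) ⊗ₜ[k] h) * Δ k 1) =
      (εs (k := k)).rTensor H (Δ k 1 * (h ⊗ₜ[k] (1 : H))) := by
    rw [← cL_Δ_one, lTensor_cL]
    have : cR' (((1 : H) ⊗ₜ[k] h) * Δ k 1) = εs ∘ₗ LinearMap.mulRight k h := by
      rw [← cR'_Δ_one]
      ext e
      change ctrR' e _ = ctrR' (e * h) _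
      induction (Δ k (1 : H) : H ⊗[k] H) using TensorProduct.induction_on with
      | zero => simp
      | tmul a b => simp [mul_assoc]
      | add u v hu hv => rw [mul_add, map_add, map_add, hu, hv]
    rw [this]
    induction (Δ k (1 : H) : H ⊗[k] H) using TensorProduct.induction_on with
    | zero => simp
    | tmul a b => simp
    | add u v hu hv => rw [add_mul, map_add, map_add, hu, hv]
  have e3 (a b : H) (s : H ⊗[k] H) : 
      LinearMap.mul' k H ((S k).rTensor H (s * (a ⊗ₜ[k] b))) =
        S k a * LinearMap.mul' k H ((S k).rTensor H s) * b := by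
    induction s using TensorProduct.induction_on with
    | zero => simp
    | tmul x y => simp [antipode_mul, mul_assoc]
    | add u v hu hv => rw [add_mul, map_add, map_add, map_add, map_add, hu, hv, mul_add, add_mul]
  have e4 (t : H ⊗[k] H) : (εs (k := k)).rTensor H (t * (h ⊗ₜ[k] (1 : H))) =
      sandwich ((εs (k := k)).rTensor H t) (Δ k h) := by
    induction t using TensorProduct.induction_on with
    | zero =>
      rw [zero_mul, map_zero]
      induction Δ k h using TensorProduct.induction_on with
      | zero => simp
      | tmul a b => simp [sandwich_tmul]
      | add u v hu hv => rw [map_add, ← hu, ← hv, add_zero]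
    | add u v hu hv =>
      rw [add_mul, map_add, hu, hv, map_add]
      induction Δ k h using TensorProduct.induction_on with
      | zero => simp
      | tmul a b => simp only [sandwich_tmul]; rw [mul_add, add_mul]
      | add u v hu hv => rw [map_add, map_add, map_add, ← hu, ← hv]; abel
    | tmul c d =>
      simp only [Algebra.TensorProduct.tmul_mul_tmul, mul_one, LinearMap.rTensor_tmul]
      rw [show εs (k := k) (c * h) = LinearMap.mul' k H ((S k).rTensor H (Δ k (c * h))) from rfl,
        Δ_mul]
      induction Δ k h using TensorProduct.induction_on with
      | zero => simp
      | tmul a b =>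
        rw [e3, sandwich_tmul]
        simp [εs]
      | add u v hu hv =>
        rw [mul_add, map_add, map_add, TensorProduct.add_tmul, hu, hv, map_add]
  rw [e1, e4, rTensor_εs_one]

end Lemmas3
end QuantumGroupoid

/-- A finite dimensional left module over a `k`-algebra `H`. -/
structure QGRep (k H : Type u) [Field k] [Ring H] [Algebra k H] where
  carrier : Type u
  [addCommGroup : AddCommGroup carrier]
  [module : Module k carrier]
  [moduleH : Module H carrier]
  [tower : IsScalarTower k H carrier]
  [finite : Module.Finite k carrier]

namespace QGRep

attribute [instance] QGRep.addCommGroup QGRep.module QGRep.moduleH QGRep.tower QGRep.finite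

section Cat

variable {k H : Type u} [Field k] [Ring H] [Algebra k H]

instance (V : QGRep k H) : SMulCommClass H k V.carrier := IsScalarTower.to_smulCommClass'
instance (V : QGRep k H) : SMulCommClass k H V.carrier := IsScalarTower.to_smulCommClass

/-- A morphism of `Rep(H)` is an `H`-linear map. -/
@[ext] structure Hom (V W : QGRep k H) where
  lin : V.carrier →ₗ[H] W.carrier

instance : Category (QGRep k H) where
  Hom V W := Hom V W
  id V := ⟨LinearMap.id⟩
  comp f g := ⟨g.lin ∘ₗ f.lin⟩

variable {U V W X Y Z : QGRep k H}

lemma hom_ext {f g : V ⟶ W} (h : ∀ x, f.lin x = g.lin x) : f = g :=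
  Hom.ext (LinearMap.ext h)

@[simp] lemma id_lin (x : V.carrier) : (𝟙 V : V ⟶ V).lin x = x := rfl
@[simp] lemma comp_lin (f : U ⟶ V) (g : V ⟶ W) (x : U.carrier) :
    (f ≫ g).lin x = g.lin (f.lin x) := rfl

/-- Morphisms are the same as `H`-linear maps. -/
def homEquiv (V W : QGRep k H) : (V ⟶ W) ≃ (V.carrier →ₗ[H] W.carrier) where
  toFun f := f.lin
  invFun f := ⟨f⟩
  left_inv _ := rfl
  right_inv _ := rfl

noncomputable instance (V W : QGRep k H) : AddCommGroup (V ⟶ W) := (homEquiv V W).addCommGroup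
noncomputable instance (V W : QGRep k H) : Module k (V ⟶ W) := (homEquiv V W).module k

@[simp] lemma add_lin (f g : V ⟶ W) (x : V.carrier) : (f + g).lin x = f.lin x + g.lin x := rfl
@[simp] lemma zero_lin (x : V.carrier) : (0 : V ⟶ W).lin x = 0 := rfl
@[simp] lemma smul_lin (c : k) (f : V ⟶ W) (x : V.carrier) : (c • f).lin x = c • f.lin x := rfl

noncomputable instance : Preadditive (QGRep k H) where
  add_comp _ _ _ _ _ _ := hom_ext fun x => by simp
  comp_add _ _ _ _ _ _ := hom_ext fun x => by simp

noncomputable instance : Linear k (QGRep k H) where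
  smul_comp _ _ _ r f g := hom_ext fun x => by
    simp only [comp_lin, smul_lin]
    exact (g.lin.restrictScalars k).map_smul r _
  comp_smul _ _ _ _ _ _ := hom_ext fun x => by simp

/-- A morphism as a `k`-linear map. -/
def klin (f : V ⟶ W) : V.carrier →ₗ[k] W.carrier := f.lin.restrictScalars k

@[simp] lemma klin_apply (f : V ⟶ W) (x : V.carrier) : klin f x = f.lin x := rfl

/-- A bijective `H`-linear map is an isomorphism. -/
def isoMk (e : V.carrier ≃ₗ[H] W.carrier) : V ≅ W where
  hom := ⟨e.toLinearMap⟩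
  inv := ⟨e.symm.toLinearMap⟩
  hom_inv_id := hom_ext fun x => by simp
  inv_hom_id := hom_ext fun x => by simp

/-- the action of `H` on `V` as an algebra homomorphism -/
noncomputable def act (V : QGRep k H) : H →ₐ[k] Module.End k V.carrier :=
  Algebra.lsmul k k V.carrier

@[simp] lemma act_apply (V : QGRep k H) (h : H) (x : V.carrier) : act V h x = h • x := rfl

/-- the componentwise action of `A ⊗ B` on `M ⊗ N` -/
noncomputable def act₂ {A B M N : Type u} [Ring A] [Algebra k A] [Ring B] [Algebra k B]
    [AddCommGroup M] [Module k M] [AddCommGroup N] [Module k N]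
    (ρ : A →ₐ[k] Module.End k M) (σ : B →ₐ[k] Module.End k N) :
    A ⊗[k] B →ₐ[k] Module.End k (M ⊗[k] N) :=
  (Module.endTensorEndAlgHom (R := k) (S := k) (A := k) (M := M) (N := N)).comp
    (Algebra.TensorProduct.map ρ σ)

@[simp] lemma act₂_tmul {A B M N : Type u} [Ring A] [Algebra k A] [Ring B] [Algebra k B]
    [AddCommGroup M] [Module k M] [AddCommGroup N] [Module k N]
    (ρ : A →ₐ[k] Module.End k M) (σ : B →ₐ[k] Module.End k N) (a : A) (b : B) (x : M) (y : N) :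
    act₂ ρ σ (a ⊗ₜ[k] b) (x ⊗ₜ[k] y) = ρ a x ⊗ₜ[k] σ b y := rfl

lemma act₂_tmul' {A B M N : Type u} [Ring A] [Algebra k A] [Ring B] [Algebra k B]
    [AddCommGroup M] [Module k M] [AddCommGroup N] [Module k N]
    (ρ : A →ₐ[k] Module.End k M) (σ : B →ₐ[k] Module.End k N) (a : A) (b : B) :
    act₂ ρ σ (a ⊗ₜ[k] b) = TensorProduct.map (ρ a) (σ b) := by
  ext; simp

/-- the componentwise action of `H ⊗ H` on `V ⊗ₖ W` -/
noncomputable abbrev actT (V W : QGRep k H) :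
    H ⊗[k] H →ₐ[k] Module.End k (V.carrier ⊗[k] W.carrier) :=
  act₂ (act V) (act W)

end Cat

open QuantumGroupoid

section Tensor

variable {k H : Type u} [Field k] [Ring H] [Algebra k H] [QuantumGroupoid k H]

/-- The subspace `{x ∈ V ⊗ₖ W | x = Δ(1)·x}` of `V ⊗ₖ W`. -/
noncomputable def tensorSub (V W : QGRep k H) : Submodule k (V.carrier ⊗[k] W.carrier) where
  carrier := {x | actT V W (Δ k 1) x = x}
  add_mem' {x y} hx hy := by
    change _ = _ at hx hy ⊢
    rw [map_add, hx, hy]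
  zero_mem' := map_zero _
  smul_mem' c x hx := by
    change _ = _ at hx ⊢
    rw [map_smul, hx]

lemma mem_tensorSub {V W : QGRep k H} {x : V.carrier ⊗[k] W.carrier} :
    x ∈ tensorSub V W ↔ actT V W (Δ k 1) x = x := Iff.rfl

lemma actT_Δ_mem (V W : QGRep k H) (h : H) (x : V.carrier ⊗[k] W.carrier) :
    actT V W (Δ k h) x ∈ tensorSub V W := by
  rw [mem_tensorSub, ← Module.End.mul_apply, ← map_mul, Δ_one_mul_Δ]

/-- `H` acts on `V ⊗ W` through the comultiplication. -/
@[reducible] noncomputable def tensorModule (V W : QGRep k H) : Module H (tensorSub V W) where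
  smul h x := ⟨actT V W (Δ k h) x, actT_Δ_mem V W h x⟩
  one_smul x := Subtype.ext x.2
  mul_smul a b x := Subtype.ext (by
    change actT V W (Δ k (a * b)) x = actT V W (Δ k a) (actT V W (Δ k b) x)
    rw [Δ_mul, map_mul, Module.End.mul_apply])
  smul_zero a := Subtype.ext (map_zero _)
  smul_add a x y := Subtype.ext (map_add _ _ _)
  add_smul a b x := Subtype.ext (by
    change actT V W (Δ k (a + b)) x = actT V W (Δ k a) x + actT V W (Δ k b) x
    rw [map_add, map_add, LinearMap.add_apply])
  zero_smul x := Subtype.ext (by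
    change actT V W (Δ k 0) x = 0
    rw [map_zero, map_zero, LinearMap.zero_apply])

/-- The tensor product `V ⊗ W = {x ∈ V ⊗ₖ W | x = Δ(1)·x}` of `Rep(H)`. -/
noncomputable def tensor (V W : QGRep k H) : QGRep k H :=
  letI := tensorModule V W
  { carrier := tensorSub V W
    tower := ⟨fun c h x => Subtype.ext (by
      change actT V W (Δ k (c • h)) x = c • actT V W (Δ k h) x
      rw [map_smul, map_smul, LinearMap.smul_apply])⟩ }

variable {U V W X Y Z : QGRep k H}

/-- The inclusion `V ⊗ W ⊂ V ⊗ₖ W`. -/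
noncomputable def inc (V W : QGRep k H) : (tensor V W).carrier →ₗ[k] V.carrier ⊗[k] W.carrier :=
  (tensorSub V W).subtype

lemma inc_injective (V W : QGRep k H) : Function.Injective (inc V W) := Subtype.val_injective

@[simp] lemma inc_smul (h : H) (x : (tensor V W).carrier) :
    inc V W (h • x) = actT V W (Δ k h) (inc V W x) := rfl

@[simp] lemma actT_one_inc (x : (tensor V W).carrier) :
    actT V W (Δ k 1) (inc V W x) = inc V W x := x.2

/-- The projection `x ↦ Δ(1)·x` of `V ⊗ₖ W` onto `V ⊗ W`. -/
noncomputable def proj (V W : QGRep k H) : V.carrier ⊗[k] W.carrier →ₗ[k] (tensor V W).carrier :=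
  (actT V W (Δ k 1)).codRestrict (tensorSub V W) (actT_Δ_mem V W 1)

@[simp] lemma inc_proj (x : V.carrier ⊗[k] W.carrier) :
    inc V W (proj V W x) = actT V W (Δ k 1) x := rfl

@[simp] lemma proj_inc (x : (tensor V W).carrier) : proj V W (inc V W x) = x :=
  inc_injective V W (by simp)

/-- `H`-linear maps into `V ⊗ W` from equivariant linear maps into `V ⊗ₖ W` -/
noncomputable def lift (g : X.carrier →ₗ[k] V.carrier ⊗[k] W.carrier)
    (hg : ∀ (h : H) x, actT V W (Δ k h) (g x) = g (h • x)) : X ⟶ tensor V W where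
  lin :=
    { toFun := fun x => proj V W (g x)
      map_add' := fun x y => by rw [map_add, map_add]
      map_smul' := fun h x => inc_injective V W (by
        simp only [inc_proj, hg, one_smul, RingHom.id_apply, inc_smul]) }

@[simp] lemma inc_lift (g : X.carrier →ₗ[k] V.carrier ⊗[k] W.carrier)
    (hg : ∀ (h : H) x, actT V W (Δ k h) (g x) = g (h • x)) (x : X.carrier) :
    inc V W ((lift g hg).lin x) = g x := by
  change inc V W (proj V W (g x)) = g x
  rw [inc_proj, hg, one_smul]

lemma actT_map {k H : Type u} [Field k] [Ring H] [Algebra k H] {V W X Y : QGRep k H}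
    (f : V ⟶ X) (g : W ⟶ Y) (s : H ⊗[k] H) (x : V.carrier ⊗[k] W.carrier) :
    actT X Y s (TensorProduct.map (klin f) (klin g) x) =
      TensorProduct.map (klin f) (klin g) (actT V W s x) := by
  induction s using TensorProduct.induction_on with
  | zero => simp
  | add a b ha hb => rw [map_add, map_add, LinearMap.add_apply, LinearMap.add_apply, ha, hb, map_add]
  | tmul a b =>
    induction x using TensorProduct.induction_on with
    | zero => simp
    | add x y hx hy => rw [map_add, map_add, hx, hy, map_add, map_add]
    | tmul x y => simp

/-- The tensor product of morphisms is the restriction of `f ⊗ₖ g`. -/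
noncomputable def tensorMap (f : V ⟶ X) (g : W ⟶ Y) : tensor V W ⟶ tensor X Y :=
  lift (TensorProduct.map (klin f) (klin g) ∘ₗ inc V W) fun h x => by
    simp [actT_map]

@[simp] lemma inc_tensorMap (f : V ⟶ X) (g : W ⟶ Y) (x : (tensor V W).carrier) :
    inc X Y ((tensorMap f g).lin x) = TensorProduct.map (klin f) (klin g) (inc V W x) :=
  inc_lift _ _ x

/-- The action of `H ⊗ H ⊗ H` on `(U ⊗ₖ V) ⊗ₖ W`. -/
noncomputable abbrev act3 (U V W : QGRep k H) :
    (H ⊗[k] H) ⊗[k] H →ₐ[k] Module.End k ((U.carrier ⊗[k] V.carrier) ⊗[k] W.carrier) :=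
  act₂ (actT U V) (act W)

/-- `(U ⊗ V) ⊗ W ⊂ (U ⊗ₖ V) ⊗ₖ W` -/
noncomputable def incL (U V W : QGRep k H) : (tensor (tensor U V) W).carrier →ₗ[k]
    (U.carrier ⊗[k] V.carrier) ⊗[k] W.carrier :=
  (inc U V).rTensor _ ∘ₗ inc (tensor U V) W

/-- `U ⊗ (V ⊗ W) ⊂ U ⊗ₖ (V ⊗ₖ W)` -/
noncomputable def incR (U V W : QGRep k H) : (tensor U (tensor V W)).carrier →ₗ[k]
    U.carrier ⊗[k] (V.carrier ⊗[k] W.carrier) :=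
  (inc V W).lTensor _ ∘ₗ inc U (tensor V W)

lemma incL_injective (U V W : QGRep k H) : Function.Injective (incL U V W) :=
  (Module.Flat.rTensor_preserves_injective_linearMap _ (inc_injective U V)).comp
    (inc_injective _ _)

lemma incR_injective (U V W : QGRep k H) : Function.Injective (incR U V W) :=
  (Module.Flat.lTensor_preserves_injective_linearMap _ (inc_injective V W)).comp
    (inc_injective _ _)

lemma rTensor_inc_actT (s : H ⊗[k] H) (x : (tensor U V).carrier ⊗[k] W.carrier) :
    (inc U V).rTensor W.carrier (actT (tensor U V) W s x) =
      act3 U V W ((Δ k).rTensor H s) ((inc U V).rTensor W.carrier x) := by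
  induction s using TensorProduct.induction_on with
  | zero => simp
  | add a b ha hb =>
    simp only [map_add, LinearMap.add_apply, ha, hb]
  | tmul a b =>
    induction x using TensorProduct.induction_on with
    | zero => simp
    | add x y hx hy => simp only [map_add, hx, hy]
    | tmul x y => simp

lemma lTensor_inc_actT (s : H ⊗[k] H) (x : U.carrier ⊗[k] (tensor V W).carrier) :
    (inc V W).lTensor U.carrier (actT U (tensor V W) s x) =
      act₂ (act U) (actT V W) ((Δ k).lTensor H s) ((inc V W).lTensor U.carrier x) := by
  induction s using TensorProduct.induction_on with
  | zero => simp
  | add a b ha hb =>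
    simp only [map_add, LinearMap.add_apply, ha, hb]
  | tmul a b =>
    induction x using TensorProduct.induction_on with
    | zero => simp
    | add x y hx hy => simp only [map_add, hx, hy]
    | tmul x y => simp

lemma assoc_act3 {k H : Type u} [Field k] [Ring H] [Algebra k H] {U V W : QGRep k H}
    (s : (H ⊗[k] H) ⊗[k] H) (x : (U.carrier ⊗[k] V.carrier) ⊗[k] W.carrier) :
    TensorProduct.assoc k _ _ _ (act3 U V W s x) =
      act₂ (act U) (actT V W) (TensorProduct.assoc k _ _ _ s) (TensorProduct.assoc k _ _ _ x) := by
  induction s using TensorProduct.induction_on with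
  | zero => simp
  | add a b ha hb => simp only [map_add, LinearMap.add_apply, ha, hb]
  | tmul s c =>
    induction s using TensorProduct.induction_on with
    | zero => simp
    | add a b ha hb => simp only [TensorProduct.add_tmul, map_add, LinearMap.add_apply, ha, hb]
    | tmul a b =>
      induction x using TensorProduct.induction_on with
      | zero => simp
      | add x y hx hy => simp only [map_add, hx, hy]
      | tmul x z =>
        induction x using TensorProduct.induction_on with
        | zero => simp
        | add x y hx hy => simp only [TensorProduct.add_tmul, map_add, hx, hy]
        | tmul x y => simp

lemma incL_smul (h : H) (x : (tensor (tensor U V) W).carrier) :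
    incL U V W (h • x) = act3 U V W ((Δ k).rTensor H (Δ k h)) (incL U V W x) := by
  simp only [incL, LinearMap.comp_apply, inc_smul, rTensor_inc_actT]

lemma incR_smul (h : H) (x : (tensor U (tensor V W)).carrier) :
    incR U V W (h • x) = act₂ (act U) (actT V W) ((Δ k).lTensor H (Δ k h)) (incR U V W x) := by
  simp only [incR, LinearMap.comp_apply, inc_smul, lTensor_inc_actT]

lemma comul_comul_one₁ : (Δ k).rTensor H (Δ k (1 : H)) =
    (Δ k 1 ⊗ₜ[k] (1 : H)) * (TensorProduct.assoc k H H H).symm ((1 : H) ⊗ₜ[k] Δ k 1) :=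
  comul_comul_one

lemma Δ_one_idem : Δ k (1 : H) * Δ k 1 = Δ k 1 := Δ_one_mul_Δ 1

/-- The associator is the restriction of the usual one. -/
noncomputable def assocFun (U V W : QGRep k H) : (tensor (tensor U V) W).carrier →ₗ[k]
    U.carrier ⊗[k] (tensor V W).carrier :=
  (proj V W).lTensor U.carrier ∘ₗ (TensorProduct.assoc k _ _ _).toLinearMap ∘ₗ incL U V W

lemma lTensor_inc_proj (x : U.carrier ⊗[k] (V.carrier ⊗[k] W.carrier)) :
    (inc V W).lTensor U.carrier ((proj V W).lTensor U.carrier x) =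
      act₂ (act U) (actT V W) ((1 : H) ⊗ₜ[k] Δ k 1) x := by
  induction x using TensorProduct.induction_on with
  | zero => simp
  | add x y hx hy => simp only [map_add, hx, hy]
  | tmul x y => simp

lemma rTensor_inc_proj (x : (U.carrier ⊗[k] V.carrier) ⊗[k] W.carrier) :
    (inc U V).rTensor W.carrier ((proj U V).rTensor W.carrier x) =
      act3 U V W (Δ k 1 ⊗ₜ[k] (1 : H)) x := by
  induction x using TensorProduct.induction_on with
  | zero => simp
  | add x y hx hy => simp only [map_add, hx, hy]
  | tmul x y => simp

lemma lTensor_inc_assocFun (x : (tensor (tensor U V) W).carrier) :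
    (inc V W).lTensor U.carrier (assocFun U V W x) =
      TensorProduct.assoc k _ _ _ (incL U V W x) := by
  have h := incL_smul (1 : H) x
  rw [one_smul, comul_comul_one''] at h
  simp only [assocFun, LinearMap.comp_apply, lTensor_inc_proj]
  rw [h]
  simp only [LinearEquiv.coe_coe, assoc_act3]
  rw [← Module.End.mul_apply, ← map_mul]
  congr 2
  have : (1 : H) ⊗ₜ[k] Δ k 1 = TensorProduct.assoc k H H H
    ((TensorProduct.assoc k H H H).symm ((1 : H) ⊗ₜ[k] Δ k 1)) := by simp
  have hm (a b : (H ⊗[k] H) ⊗[k] H) : TensorProduct.assoc k H H H a * TensorProduct.assoc k H H H b =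
    TensorProduct.assoc k H H H (a * b) :=
      (map_mul (Algebra.TensorProduct.assoc k k k H H H) a b).symm
  have hs (a b : H ⊗[k] (H ⊗[k] H)) : (TensorProduct.assoc k H H H).symm a *
      (TensorProduct.assoc k H H H).symm b = (TensorProduct.assoc k H H H).symm (a * b) :=
      (map_mul (Algebra.TensorProduct.assoc k k k H H H).symm a b).symm
  conv_lhs => rw [this]
  rw [hm, ← mul_assoc, hs]
  simp [Δ_one_idem]

lemma lTensor_inc_injective : Function.Injective ((inc V W).lTensor U.carrier) :=
  Module.Flat.lTensor_preserves_injective_linearMap _ (inc_injective V W)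

lemma rTensor_inc_injective : Function.Injective ((inc U V).rTensor W.carrier) :=
  Module.Flat.rTensor_preserves_injective_linearMap _ (inc_injective U V)

/-- The associator, as a morphism. -/
noncomputable def assocHom (U V W : QGRep k H) : tensor (tensor U V) W ⟶ tensor U (tensor V W) :=
  lift (assocFun U V W) fun h x => lTensor_inc_injective (by
    rw [lTensor_inc_actT, lTensor_inc_assocFun, lTensor_inc_assocFun, incL_smul, assoc_act3,
      coassoc_symm, LinearEquiv.apply_symm_apply])

lemma incR_assocHom (x : (tensor (tensor U V) W).carrier) :
    incR U V W ((assocHom U V W).lin x) = TensorProduct.assoc k _ _ _ (incL U V W x) := by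
  simp [incR, assocHom, lTensor_inc_assocFun]

lemma assocHom_bijective (U V W : QGRep k H) : Function.Bijective (assocHom U V W).lin := by
  constructor
  · intro x y hxy
    apply incL_injective
    apply (TensorProduct.assoc k _ _ _).injective
    rw [← incR_assocHom, ← incR_assocHom, hxy]
  · intro y
    set y' := (TensorProduct.assoc k _ _ _).symm (incR U V W y) with hy'
    have hyy : incR U V W y = TensorProduct.assoc k _ _ _ y' := by simp [hy']
    have h := incR_smul (1 : H) y
    rw [one_smul] at h
    have h3 : act3 U V W ((Δ k).rTensor H (Δ k 1)) y' = y' := by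
      apply (TensorProduct.assoc k _ _ _).injective
      rw [assoc_act3, ← hyy, coassoc_symm, LinearEquiv.apply_symm_apply, ← h]
    have h4 : (inc U V).rTensor W.carrier ((proj U V).rTensor W.carrier y') = y' := by
      rw [rTensor_inc_proj, ← h3, ← Module.End.mul_apply, ← map_mul, comul_comul_one₁, ← mul_assoc]
      simp [Δ_one_idem]
    refine ⟨proj (tensor U V) W ((proj U V).rTensor W.carrier y'), ?_⟩
    apply incR_injective
    rw [incR_assocHom, hyy]
    congr 1
    rw [incL, LinearMap.comp_apply, inc_proj, rTensor_inc_actT, h4, h3]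

/-- The associativity isomorphism of `Rep(H)`, the restriction of the usual one. -/
noncomputable def associator (U V W : QGRep k H) :
    tensor (tensor U V) W ≅ tensor U (tensor V W) :=
  isoMk (LinearEquiv.ofBijective (assocHom U V W).lin (assocHom_bijective U V W))

lemma incR_associator (x : (tensor (tensor U V) W).carrier) :
    incR U V W ((associator U V W).hom.lin x) = TensorProduct.assoc k _ _ _ (incL U V W x) :=
  incR_assocHom x

end Tensor
end QGRep

namespace QGRep
open QuantumGroupoid

section Unit

variable (k H : Type u) [Field k] [Ring H] [Algebra k H] [QuantumGroupoid k H]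

/-- The target counital subalgebra `H_t = ε_t(H)`. -/
noncomputable def targetSub : Submodule k H := LinearMap.range (εt k)

variable {k H} in
lemma εt_of_mem {z : H} (hz : z ∈ targetSub k H) : εt k z = z := by
  obtain ⟨w, rfl⟩ := hz
  exact εt_εt w

/-- The action `h · z = ε_t(hz)` of `H` on `H_t`. -/
@[reducible] noncomputable def targetModule : Module H (targetSub k H) where
  smul h z := ⟨εt k (h * z), LinearMap.mem_range_self _ _⟩
  one_smul z := Subtype.ext (by
    change εt k (1 * (z : H)) = z
    rw [one_mul, εt_of_mem z.2])
  mul_smul a b z := Subtype.ext (by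
    change εt k (a * b * (z : H)) = εt k (a * εt k (b * z))
    rw [εt_mul_εt, mul_assoc])
  smul_zero a := Subtype.ext (by
    change εt k (a * 0) = 0
    rw [mul_zero, map_zero])
  smul_add a x y := Subtype.ext (by
    change εt k (a * (x + y)) = εt k (a * x) + εt k (a * y)
    rw [mul_add, map_add])
  add_smul a b x := Subtype.ext (by
    change εt k ((a + b) * x) = εt k (a * x) + εt k (b * x)
    rw [add_mul, map_add])
  zero_smul x := Subtype.ext (by
    change εt k (0 * (x : H)) = 0
    rw [zero_mul, map_zero])

/-- The unit object `H_t` of `Rep(H)`. -/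
noncomputable def unitObj : QGRep k H :=
  letI := targetModule k H
  haveI : Module.Finite k H := QuantumGroupoid.finite
  { carrier := targetSub k H
    tower := ⟨fun c h z => Subtype.ext (by
      change εt k ((c • h) * (z : H)) = c • εt k (h * z)
      rw [smul_mul_assoc, map_smul])⟩ }

variable {k H}

/-- The inclusion `H_t ⊂ H`. -/
noncomputable def uinc : (unitObj k H).carrier →ₗ[k] H := (targetSub k H).subtype

lemma uinc_injective : Function.Injective (uinc (k := k) (H := H)) := Subtype.val_injective

@[simp] lemma uinc_smul (h : H) (z : (unitObj k H).carrier) :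
    uinc (h • z) = εt k (h * uinc z) := rfl

@[simp] lemma εt_uinc (z : (unitObj k H).carrier) : εt k (uinc z) = uinc z := εt_of_mem z.2

/-- `ε_t : H → H_t` -/
noncomputable def uproj : H →ₗ[k] (unitObj k H).carrier := (εt k).rangeRestrict

@[simp] lemma uinc_uproj (h : H) : uinc (uproj (k := k) h) = εt k h := rfl

variable (V : QGRep k H)

/-- `z ⊗ v ↦ z·v` -/
noncomputable def leftFun : (tensor (unitObj k H) V).carrier →ₗ[k] V.carrier :=
  TensorProduct.lift ((act V).toLinearMap ∘ₗ uinc) ∘ₗ inc _ _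

/-- `z ⊗ v ↦ ε(z) v` -/
noncomputable def epsL : (unitObj k H).carrier ⊗[k] V.carrier →ₗ[k] V.carrier :=
  (TensorProduct.lid k _).toLinearMap ∘ₗ (ε k ∘ₗ uinc).rTensor _

/-- `v ⊗ z ↦ ε(z) v` -/
noncomputable def epsR : V.carrier ⊗[k] (unitObj k H).carrier →ₗ[k] V.carrier :=
  (TensorProduct.rid k _).toLinearMap ∘ₗ (ε k ∘ₗ uinc).lTensor _

@[simp] lemma epsL_tmul (z : (unitObj k H).carrier) (v : V.carrier) :
    epsL V (z ⊗ₜ v) = ε k (uinc z) • v := by simp [epsL]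

@[simp] lemma epsR_tmul (z : (unitObj k H).carrier) (v : V.carrier) :
    epsR V (v ⊗ₜ z) = ε k (uinc z) • v := by simp [epsR]

lemma epsL_act (s : H ⊗[k] H) (z : (unitObj k H).carrier) (v : V.carrier) :
    epsL V (actT _ V s (z ⊗ₜ v)) = ctrL (uinc z) s • v := by
  induction s using TensorProduct.induction_on with
  | zero => simp
  | add a b ha hb => simp only [map_add, LinearMap.add_apply, ha, hb, add_smul]
  | tmul a b => simp [ε_εt]

lemma epsR_act (s : H ⊗[k] H) (z : (unitObj k H).carrier) (v : V.carrier) :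
    epsR V (actT V _ s (v ⊗ₜ z)) = ctrR (uinc z) s • v := by
  induction s using TensorProduct.induction_on with
  | zero => simp
  | add a b ha hb => simp only [map_add, LinearMap.add_apply, ha, hb, add_smul]
  | tmul a b => simp [ε_εt]

lemma epsL_Δ (h : H) (x : (unitObj k H).carrier ⊗[k] V.carrier) :
    epsL V (actT _ V (Δ k h) x) =
      h • TensorProduct.lift ((act V).toLinearMap ∘ₗ uinc) x := by
  induction x using TensorProduct.induction_on with
  | zero => simp
  | add x y hx hy => simp only [map_add, hx, hy, smul_add]
  | tmul z v =>
    rw [epsL_act, ctrL_Δ, ← εt_eq_ctrL, εt_uinc, mul_smul]; simp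

lemma epsL_inc (x : (tensor (unitObj k H) V).carrier) : epsL V (inc _ _ x) = leftFun V x := by
  rw [← actT_one_inc, epsL_Δ, one_smul]; rfl

/-- `l_V : H_t ⊗ V → V`, `z ⊗ v ↦ z·v` -/
noncomputable def leftHom : tensor (unitObj k H) V ⟶ V where
  lin :=
    { toFun := leftFun V
      map_add' := map_add _
      map_smul' := fun h x => by
        rw [← epsL_inc, inc_smul, epsL_Δ]; rfl }

@[simp] lemma leftHom_lin (x : (tensor (unitObj k H) V).carrier) :
    (leftHom V).lin x = epsL V (inc _ _ x) := (epsL_inc V x).symm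

lemma uinc_one_eq : uinc (uproj (k := k) (1 : H)) = 1 := by rw [uinc_uproj, εt_one]

lemma leftHom_bijective : Function.Bijective (leftHom V).lin := by
  have h1 (v : V.carrier) : (leftHom V).lin (proj _ _ (uproj (k := k) (1 : H) ⊗ₜ v)) = v := by
    rw [leftHom_lin, inc_proj, epsL_act, uinc_one_eq, ctrL_one, one_smul]
  refine ⟨?_, fun v => ⟨_, h1 v⟩⟩
  have h2 (x : (tensor (unitObj k H) V).carrier) :
      proj _ _ (uproj (k := k) (1 : H) ⊗ₜ (leftHom V).lin x) = x := by
    have key (y : (unitObj k H).carrier ⊗[k] V.carrier) :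
        actT _ V (Δ k 1) (uproj (k := k) (1 : H) ⊗ₜ
          TensorProduct.lift ((act V).toLinearMap ∘ₗ uinc) y) = actT _ V (Δ k 1) y := by
      induction y using TensorProduct.induction_on with
      | zero => simp
      | add x y hx hy => simp only [map_add, TensorProduct.tmul_add, hx, hy]
      | tmul z v =>
        let P : H ⊗[k] H →ₗ[k] (unitObj k H).carrier ⊗[k] V.carrier :=
          TensorProduct.map uproj ((LinearMap.flip (act V).toLinearMap) v)
        have hu (x : H) : uproj (εt k x) = uproj (k := k) x :=
          uinc_injective (by simp [εt_εt])
        have hP (s : H ⊗[k] H) : P ((εt k).rTensor H s) = P s := by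
          induction s using TensorProduct.induction_on with
          | zero => simp
          | add x y hx hy => simp only [map_add, hx, hy]
          | tmul a b => simp [P, hu]
        have e1 (s : H ⊗[k] H) : actT _ V s (uproj (k := k) (1 : H) ⊗ₜ (uinc z • v)) =
            P (s * ((1 : H) ⊗ₜ[k] uinc z)) := by
          induction s using TensorProduct.induction_on with
          | zero => simp
          | add x y hx hy => simp only [map_add, add_mul, hx, hy, LinearMap.add_apply]
          | tmul a b =>
            simp only [act₂_tmul, act_apply, Algebra.TensorProduct.tmul_mul_tmul, mul_one, P,
              TensorProduct.map_tmul, LinearMap.flip_apply, AlgHom.toLinearMap_apply, mul_smul]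
            congr 1
            exact uinc_injective (by simp [εt_one])
        have e2 (s : H ⊗[k] H) : actT _ V s (z ⊗ₜ v) = P (s * (uinc z ⊗ₜ[k] (1 : H))) := by
          induction s using TensorProduct.induction_on with
          | zero => simp
          | add x y hx hy => simp only [map_add, add_mul, hx, hy, LinearMap.add_apply]
          | tmul a b =>
            simp only [act₂_tmul, act_apply, Algebra.TensorProduct.tmul_mul_tmul, mul_one, P,
              TensorProduct.map_tmul, LinearMap.flip_apply, AlgHom.toLinearMap_apply]
            congr 1
        have e3 : Δ k (uinc z) = Δ k 1 * (uinc z ⊗ₜ[k] (1 : H)) := by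
          rw [← εt_uinc z, Δ_εt]
        simp only [TensorProduct.lift.tmul, LinearMap.comp_apply, AlgHom.toLinearMap_apply,
          act_apply]
        rw [e1, e2, ← hP, ← e3, ← rTensor_εt_Δ, hP]
    apply inc_injective
    rw [inc_proj]
    exact (key _).trans (actT_one_inc x)
  exact fun x y h => by rw [← h2 x, ← h2 y, h]

/-- `v ⊗ z ↦ ε(z) v`, the inverse of `v ↦ 1₍₁₎·v ⊗ 1₍₂₎` -/
noncomputable def rightHom : tensor V (unitObj k H) ⟶ V where
  lin :=
    { toFun := fun x => epsR V (inc _ _ x)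
      map_add' := fun x y => by rw [map_add, map_add]
      map_smul' := fun h x => by
        have key (h : H) (x : V.carrier ⊗[k] (unitObj k H).carrier) :
            epsR V (actT V _ (Δ k h) x) = h • epsR V (actT V _ (Δ k 1) x) := by
          induction x using TensorProduct.induction_on with
          | zero => simp
          | add x y hx hy => simp only [map_add, hx, hy, smul_add]
          | tmul v z => rw [epsR_act, epsR_act, ctrR_Δ, mul_smul]
        rw [inc_smul, key, actT_one_inc]; rfl }

@[simp] lemma rightHom_lin (x : (tensor V (unitObj k H)).carrier) :
    (rightHom V).lin x = epsR V (inc _ _ x) := rfl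

lemma rightHom_bijective : Function.Bijective (rightHom V).lin := by
  have h1 (v : V.carrier) : (rightHom V).lin (proj _ _ (v ⊗ₜ uproj (k := k) (1 : H))) = v := by
    rw [rightHom_lin, inc_proj, epsR_act, uinc_one_eq, ctrR_one, one_smul]
  refine ⟨?_, fun v => ⟨_, h1 v⟩⟩
  have h2 (x : (tensor V (unitObj k H)).carrier) :
      proj _ _ ((rightHom V).lin x ⊗ₜ uproj (k := k) (1 : H)) = x := by
    have key (y : V.carrier ⊗[k] (unitObj k H).carrier) :
        actT V _ (Δ k 1) (epsR V (actT V _ (Δ k 1) y) ⊗ₜ uproj (k := k) (1 : H)) =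
          actT V _ (Δ k 1) y := by
      induction y using TensorProduct.induction_on with
      | zero => simp
      | add x y hx hy => simp only [map_add, TensorProduct.add_tmul, hx, hy]
      | tmul v z =>
        let P : H ⊗[k] H →ₗ[k] V.carrier ⊗[k] (unitObj k H).carrier :=
          TensorProduct.map ((LinearMap.flip (act V).toLinearMap) v) uproj
        have hu (x : H) : uproj (εt k x) = uproj (k := k) x :=
          uinc_injective (by simp [εt_εt])
        have hP (s : H ⊗[k] H) : P ((εt k).lTensor H s) = P s := by
          induction s using TensorProduct.induction_on with
          | zero => simp
          | add x y hx hy => simp only [map_add, hx, hy]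
          | tmul a b => simp [P, hu]
        have e1 (y : H) (s : H ⊗[k] H) : actT V _ s ((y • v) ⊗ₜ uproj (k := k) (1 : H)) =
            P (s * (y ⊗ₜ[k] (1 : H))) := by
          induction s using TensorProduct.induction_on with
          | zero => simp
          | add x y hx hy => simp only [map_add, add_mul, hx, hy, LinearMap.add_apply]
          | tmul a b =>
            simp only [act₂_tmul, act_apply, Algebra.TensorProduct.tmul_mul_tmul, mul_one, P,
              TensorProduct.map_tmul, LinearMap.flip_apply, AlgHom.toLinearMap_apply, mul_smul]
            congr 1
            exact uinc_injective (by simp [εt_one])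
        have e2 (s : H ⊗[k] H) : actT V _ s (v ⊗ₜ z) = P (s * ((1 : H) ⊗ₜ[k] uinc z)) := by
          induction s using TensorProduct.induction_on with
          | zero => simp
          | add x y hx hy => simp only [map_add, add_mul, hx, hy, LinearMap.add_apply]
          | tmul a b =>
            simp only [act₂_tmul, act_apply, Algebra.TensorProduct.tmul_mul_tmul, mul_one, P,
              TensorProduct.map_tmul, LinearMap.flip_apply, AlgHom.toLinearMap_apply]
            congr 1
        rw [epsR_act, e1, e2, ← hP, ← lTensor_εt_one_mul, hP]
    apply inc_injective
    rw [inc_proj, rightHom_lin]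
    have := key (inc _ _ x)
    rwa [actT_one_inc] at this
  exact fun x y h => by rw [← h2 x, ← h2 y, h]

/-- The left unit isomorphism `H_t ⊗ V ≅ V`. -/
noncomputable def leftUnitor : tensor (unitObj k H) V ≅ V :=
  isoMk (LinearEquiv.ofBijective (leftHom V).lin (leftHom_bijective V))

/-- The right unit isomorphism `V ⊗ H_t ≅ V`. -/
noncomputable def rightUnitor : tensor V (unitObj k H) ≅ V :=
  isoMk (LinearEquiv.ofBijective (rightHom V).lin (rightHom_bijective V))

lemma leftUnitor_lin (x : (tensor (unitObj k H) V).carrier) :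
    (leftUnitor V).hom.lin x = epsL V (inc _ _ x) := leftHom_lin V x

lemma rightUnitor_lin (x : (tensor V (unitObj k H)).carrier) :
    (rightUnitor V).hom.lin x = epsR V (inc _ _ x) := rfl

/-- the inverse of the right unit isomorphism is `v ↦ 1₍₁₎·v ⊗ 1₍₂₎` -/
lemma rightUnitor_inv_lin (v : V.carrier) :
    (rightUnitor V).inv.lin v = proj _ _ (v ⊗ₜ uproj (k := k) (1 : H)) := by
  apply (rightHom_bijective V).1
  change (rightUnitor V).hom.lin ((rightUnitor V).inv.lin v) = _
  rw [← comp_lin, Iso.inv_hom_id, rightHom_lin, inc_proj, epsR_act, uinc_one_eq, ctrR_one,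
    one_smul, id_lin]

end Unit

section Monoidal

variable {k H : Type u} [Field k] [Ring H] [Algebra k H] [QuantumGroupoid k H]
variable {U V W X Y Z : QGRep k H}

lemma map_map_apply {k A B A' B' A'' B'' : Type u} [Field k] [AddCommGroup A] [Module k A]
    [AddCommGroup B] [Module k B] [AddCommGroup A'] [Module k A'] [AddCommGroup B'] [Module k B']
    [AddCommGroup A''] [Module k A''] [AddCommGroup B''] [Module k B'']
    (f : A →ₗ[k] A') (g : B →ₗ[k] B') (f' : A' →ₗ[k] A'') (g' : B' →ₗ[k] B'') (x : A ⊗[k] B) :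
    TensorProduct.map f' g' (TensorProduct.map f g x) =
      TensorProduct.map (f' ∘ₗ f) (g' ∘ₗ g) x := by
  rw [TensorProduct.map_comp]; rfl

lemma klin_id {k H : Type u} [Field k] [Ring H] [Algebra k H] {V : QGRep k H} : klin (𝟙 V) = LinearMap.id := rfl
lemma klin_comp {k H : Type u} [Field k] [Ring H] [Algebra k H] {U V W : QGRep k H} (f : U ⟶ V) (g : V ⟶ W) : klin (f ≫ g) = klin g ∘ₗ klin f := rfl

lemma klin_tensorMap (f : V ⟶ X) (g : W ⟶ Y) : inc X Y ∘ₗ klin (tensorMap f g) =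
    TensorProduct.map (klin f) (klin g) ∘ₗ inc V W :=
  LinearMap.ext fun x => inc_tensorMap f g x

lemma klin_associator : incR U V W ∘ₗ klin (associator U V W).hom =
    (TensorProduct.assoc k _ _ _).toLinearMap ∘ₗ incL U V W :=
  LinearMap.ext fun x => incR_associator x

lemma klin_leftUnitor : klin (leftUnitor V).hom = epsL V ∘ₗ inc _ _ :=
  LinearMap.ext fun x => leftUnitor_lin V x

lemma klin_rightUnitor : klin (rightUnitor V).hom = epsR V ∘ₗ inc _ _ := rfl

noncomputable instance : MonoidalCategoryStruct (QGRep k H) where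
  tensorObj := tensor
  whiskerLeft V _ _ f := tensorMap (𝟙 V) f
  whiskerRight f W := tensorMap f (𝟙 W)
  tensorHom := tensorMap
  tensorUnit := unitObj k H
  associator := associator
  leftUnitor := leftUnitor
  rightUnitor := rightUnitor

lemma tensorMap_comp (f : U ⟶ V) (g : V ⟶ W) (f' : X ⟶ Y) (g' : Y ⟶ Z) :
    tensorMap (f ≫ g) (f' ≫ g') = tensorMap f f' ≫ tensorMap g g' :=
  hom_ext fun x => inc_injective _ _ (by
    simp only [inc_tensorMap, comp_lin, klin_comp, TensorProduct.map_comp, LinearMap.comp_apply])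

lemma tensorMap_id : tensorMap (𝟙 V) (𝟙 W) = 𝟙 (tensor V W) :=
  hom_ext fun x => inc_injective _ _ (by
    simp only [inc_tensorMap, klin_id, TensorProduct.map_id, LinearMap.id_apply, id_lin])

lemma incL_tensorMap (f : U ⟶ X) (g : V ⟶ Y) (h : W ⟶ Z) (x : (tensor (tensor U V) W).carrier) :
    incL X Y Z ((tensorMap (tensorMap f g) h).lin x) =
      TensorProduct.map (TensorProduct.map (klin f) (klin g)) (klin h) (incL U V W x) := by
  simp only [incL, LinearMap.comp_apply, inc_tensorMap]
  rw [LinearMap.rTensor_def, LinearMap.rTensor_def, map_map_apply, map_map_apply, klin_tensorMap]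
  rfl

lemma incR_tensorMap (f : U ⟶ X) (g : V ⟶ Y) (h : W ⟶ Z) (x : (tensor U (tensor V W)).carrier) :
    incR X Y Z ((tensorMap f (tensorMap g h)).lin x) =
      TensorProduct.map (klin f) (TensorProduct.map (klin g) (klin h)) (incR U V W x) := by
  simp only [incR, LinearMap.comp_apply, inc_tensorMap]
  rw [LinearMap.lTensor_def, LinearMap.lTensor_def, map_map_apply, map_map_apply, klin_tensorMap]
  rfl

lemma map_map_assoc {A B C A' B' C' : Type u} [AddCommGroup A] [Module k A] [AddCommGroup B]
    [Module k B] [AddCommGroup C] [Module k C] [AddCommGroup A'] [Module k A'] [AddCommGroup B']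
    [Module k B'] [AddCommGroup C'] [Module k C'] (f : A →ₗ[k] A') (g : B →ₗ[k] B')
    (h : C →ₗ[k] C') (x : (A ⊗[k] B) ⊗[k] C) :
    TensorProduct.map f (TensorProduct.map g h) (TensorProduct.assoc k _ _ _ x) =
      TensorProduct.assoc k _ _ _ (TensorProduct.map (TensorProduct.map f g) h x) := by
  have : TensorProduct.map f (TensorProduct.map g h) ∘ₗ (TensorProduct.assoc k A B C).toLinearMap =
      (TensorProduct.assoc k A' B' C').toLinearMap ∘ₗ
        TensorProduct.map (TensorProduct.map f g) h := by
    ext; simp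
  exact LinearMap.congr_fun this x

lemma pentagon_aux (x : (tensor (tensor (tensor U V) W) X).carrier) :
    (tensorMap (𝟙 U) (associator V W X).hom).lin ((associator U (tensor V W) X).hom.lin
      ((tensorMap (associator U V W).hom (𝟙 X)).lin x)) =
    (associator U V (tensor W X)).hom.lin ((associator (tensor U V) W X).hom.lin x) := by
  -- both sides are compared inside `U ⊗ₖ (V ⊗ₖ (W ⊗ₖ X))`
  apply inc_injective
  apply Module.Flat.lTensor_preserves_injective_linearMap _ (incR_injective V W X)
  rw [inc_tensorMap]
  -- elements of the big tensor products
  set I4 : (tensor (tensor (tensor U V) W) X).carrier →ₗ[k]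
    ((U.carrier ⊗[k] V.carrier) ⊗[k] W.carrier) ⊗[k] X.carrier :=
      (incL U V W).rTensor _ ∘ₗ inc _ _ with hI4
  -- left-hand side
  have L1 (y : U.carrier ⊗[k] (tensor (tensor V W) X).carrier) :
      (incR V W X).lTensor U.carrier
        (TensorProduct.map (klin (𝟙 U)) (klin (associator V W X).hom) y) =
      (TensorProduct.assoc k _ _ _).toLinearMap.lTensor U.carrier
        ((incL V W X).lTensor U.carrier y) := by
    rw [klin_id]
    change (incR V W X).lTensor U.carrier ((klin (associator V W X).hom).lTensor U.carrier y) = _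
    rw [← LinearMap.comp_apply, ← LinearMap.comp_apply, ← LinearMap.lTensor_comp,
      ← LinearMap.lTensor_comp, klin_associator]
  have L2 (y : (tensor U (tensor (tensor V W) X)).carrier) :
      (incL V W X).lTensor U.carrier (inc _ _ y) =
      ((inc V W).rTensor X.carrier).lTensor U.carrier (incR U (tensor V W) X y) := by
    simp only [incL, incR, LinearMap.lTensor_comp, LinearMap.comp_apply]
  have L3 (y : (tensor (tensor U (tensor V W)) X).carrier) :
      ((inc V W).rTensor X.carrier).lTensor U.carrier
        (TensorProduct.assoc k _ _ _ (incL U (tensor V W) X y)) =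
      TensorProduct.assoc k _ _ _ ((incR U V W).rTensor X.carrier (inc _ _ y)) := by
    simp only [incR, incL, LinearMap.rTensor_comp, LinearMap.comp_apply]
    exact map_map_assoc _ _ _ _
  have L4 : (incR U V W).rTensor X.carrier
      (TensorProduct.map (klin (associator U V W).hom) (klin (𝟙 X)) (inc _ _ x)) =
      (TensorProduct.assoc k _ _ _).toLinearMap.rTensor X.carrier (I4 x) := by
    rw [klin_id]
    change (incR U V W).rTensor X.carrier
      ((klin (associator U V W).hom).rTensor X.carrier (inc _ _ x)) = _
    rw [← LinearMap.comp_apply, ← LinearMap.rTensor_comp, klin_associator, hI4,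
      LinearMap.rTensor_comp]
    rfl
  rw [L1, L2, incR_associator, L3, inc_tensorMap, L4]
  -- right-hand side
  have R1 (y : (tensor U (tensor V (tensor W X))).carrier) :
      (incR V W X).lTensor U.carrier (inc _ _ y) =
      ((inc W X).lTensor V.carrier).lTensor U.carrier (incR U V (tensor W X) y) := by
    simp only [incR, LinearMap.lTensor_comp, LinearMap.comp_apply]
  have R2 (y : (tensor (tensor U V) (tensor W X)).carrier) :
      ((inc W X).lTensor V.carrier).lTensor U.carrier
        (TensorProduct.assoc k _ _ _ (incL U V (tensor W X) y)) =
      TensorProduct.assoc k _ _ _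
        ((inc U V).rTensor _ (incR (tensor U V) W X y)) := by
    simp only [incR, incL, LinearMap.comp_apply]
    refine (map_map_assoc _ _ _ _).trans ?_
    congr 1
    rw [TensorProduct.map_id, LinearMap.lTensor_def, LinearMap.rTensor_def, LinearMap.rTensor_def,
      map_map_apply, map_map_apply]
    rfl
  have R3 : (inc U V).rTensor _ (TensorProduct.assoc k _ _ _ (incL (tensor U V) W X x)) =
      TensorProduct.assoc k _ _ _ (I4 x) := by
    simp only [hI4, incL, LinearMap.comp_apply, LinearMap.rTensor_comp]
    rw [LinearMap.rTensor_def, ← TensorProduct.map_id]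
    exact map_map_assoc _ _ _ _
  rw [R1, incR_associator, R2, incR_associator, R3]
  generalize I4 x = y
  have : ((TensorProduct.assoc k V.carrier W.carrier X.carrier).toLinearMap.lTensor U.carrier) ∘ₗ
      (TensorProduct.assoc k U.carrier (V.carrier ⊗[k] W.carrier) X.carrier).toLinearMap ∘ₗ
      ((TensorProduct.assoc k U.carrier V.carrier W.carrier).toLinearMap.rTensor X.carrier) =
      (TensorProduct.assoc k U.carrier V.carrier (W.carrier ⊗[k] X.carrier)).toLinearMap ∘ₗ
      (TensorProduct.assoc k (U.carrier ⊗[k] V.carrier) W.carrier X.carrier).toLinearMap := by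
    ext; simp
  exact LinearMap.congr_fun this y

lemma triangle_aux (x : (tensor (tensor U (unitObj k H)) V).carrier) :
    (tensorMap (𝟙 U) (leftUnitor V).hom).lin ((associator U (unitObj k H) V).hom.lin x) =
      (tensorMap (rightUnitor U).hom (𝟙 V)).lin x := by
  apply inc_injective
  rw [inc_tensorMap, inc_tensorMap, klin_leftUnitor, klin_rightUnitor, klin_id, klin_id]
  change ((epsL V ∘ₗ inc _ _).lTensor U.carrier) _ = ((epsR U ∘ₗ inc _ _).rTensor V.carrier) _
  rw [LinearMap.lTensor_comp, LinearMap.rTensor_comp, LinearMap.comp_apply, LinearMap.comp_apply]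
  change (epsL V).lTensor U.carrier (incR _ _ _ _) = (epsR U).rTensor V.carrier (incL _ _ _ x)
  rw [incR_associator]
  generalize incL U (unitObj k H) V x = y
  have : (epsL V).lTensor U.carrier ∘ₗ (TensorProduct.assoc k _ _ _).toLinearMap =
      (epsR U).rTensor V.carrier := by
    ext u z v
    simp [TensorProduct.smul_tmul]
  exact LinearMap.congr_fun this y

noncomputable instance : MonoidalCategory (QGRep k H) where
  tensorHom_def f g := by
    change tensorMap _ _ = tensorMap _ _ ≫ tensorMap _ _
    rw [← tensorMap_comp, Category.comp_id, Category.id_comp]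
  id_tensorHom_id _ _ := tensorMap_id
  tensorHom_comp_tensorHom _ _ _ _ := (tensorMap_comp _ _ _ _).symm
  whiskerLeft_id _ _ := tensorMap_id
  id_whiskerRight _ _ := tensorMap_id
  associator_naturality f g h := hom_ext fun x => incR_injective _ _ _ (by
    change incR _ _ _ ((associator _ _ _).hom.lin ((tensorMap (tensorMap f g) h).lin x)) =
      incR _ _ _ ((tensorMap f (tensorMap g h)).lin ((associator _ _ _).hom.lin x))
    rw [incR_associator, incL_tensorMap, incR_tensorMap, incR_associator, map_map_assoc])
  leftUnitor_naturality {V W} f := hom_ext fun x => by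
    change (leftUnitor W).hom.lin ((tensorMap (𝟙 _) f).lin x) = f.lin ((leftUnitor V).hom.lin x)
    rw [leftUnitor_lin, leftUnitor_lin, inc_tensorMap]
    generalize inc _ _ x = y
    induction y using TensorProduct.induction_on with
    | zero => simp
    | add x y hx hy => simp only [map_add, hx, hy]
    | tmul z v =>
      change epsL W (z ⊗ₜ f.lin v) = f.lin (epsL V (z ⊗ₜ v))
      rw [epsL_tmul, epsL_tmul]
      exact ((klin f).map_smul _ _).symm
  rightUnitor_naturality {V W} f := hom_ext fun x => by
    change (rightUnitor W).hom.lin ((tensorMap f (𝟙 _)).lin x) = f.lin ((rightUnitor V).hom.lin x)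
    rw [rightUnitor_lin, rightUnitor_lin, inc_tensorMap]
    generalize inc _ _ x = y
    induction y using TensorProduct.induction_on with
    | zero => simp
    | add x y hx hy => simp only [map_add, hx, hy]
    | tmul v z =>
      change epsR W (f.lin v ⊗ₜ z) = f.lin (epsR V (v ⊗ₜ z))
      rw [epsR_tmul, epsR_tmul]
      exact ((klin f).map_smul _ _).symm
  pentagon U V W X := hom_ext fun x => pentagon_aux x
  triangle U V := hom_ext fun x => triangle_aux x

instance : MonoidalPreadditive (QGRep k H) where
  whiskerLeft_zero := hom_ext fun x => inc_injective _ _ (by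
    refine (inc_tensorMap _ _ x).trans ?_
    rw [show klin (0 : _ ⟶ _) = 0 from rfl, TensorProduct.map_zero_right]; rfl)
  zero_whiskerRight := hom_ext fun x => inc_injective _ _ (by
    refine (inc_tensorMap _ _ x).trans ?_
    rw [show klin (0 : _ ⟶ _) = 0 from rfl, TensorProduct.map_zero_left]; rfl)
  whiskerLeft_add f g := hom_ext fun x => inc_injective _ _ (by
    refine (inc_tensorMap _ _ x).trans ?_
    rw [show klin (f + g) = klin f + klin g from rfl, TensorProduct.map_add_right]
    exact congrArg₂ (· + ·) (inc_tensorMap _ _ x).symm (inc_tensorMap _ _ x).symm)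
  add_whiskerRight f g := hom_ext fun x => inc_injective _ _ (by
    refine (inc_tensorMap _ _ x).trans ?_
    rw [show klin (f + g) = klin f + klin g from rfl, TensorProduct.map_add_left]
    exact congrArg₂ (· + ·) (inc_tensorMap _ _ x).symm (inc_tensorMap _ _ x).symm)

instance : MonoidalLinear k (QGRep k H) where
  whiskerLeft_smul V _ _ r f := hom_ext fun x => inc_injective _ _ (by
    refine (inc_tensorMap _ _ x).trans ?_
    rw [show klin (r • f) = r • klin f from rfl, TensorProduct.map_smul_right]
    exact congrArg (r • ·) (inc_tensorMap _ _ x).symm)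
  smul_whiskerRight r _ _ f V := hom_ext fun x => inc_injective _ _ (by
    refine (inc_tensorMap _ _ x).trans ?_
    rw [show klin (r • f) = r • klin f from rfl, TensorProduct.map_smul_left]
    exact congrArg (r • ·) (inc_tensorMap _ _ x).symm)

end Monoidal
end QGRep

/-- A twist on a braided category with (right) duals which is compatible with duality. -/
class RibbonCategory (C : Type*) [Category C] [MonoidalCategory C] [BraidedCategory C]
    [RightRigidCategory C] where
  twist (X : C) : X ≅ X
  twist_naturality {X Y : C} (f : X ⟶ Y) : f ≫ (twist Y).hom = (twist X).hom ≫ f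
  twist_tensor (X Y : C) : (twist (X ⊗ Y)).hom =
    ((twist X).hom ⊗ₘ (twist Y).hom) ≫ (β_ X Y).hom ≫ (β_ Y X).hom
  twist_dual (X : C) : η_ X Xᘁ ≫ (twist X).hom ▷ Xᘁ = η_ X Xᘁ ≫ X ◁ (twist Xᘁ).hom

namespace QGRep
open QuantumGroupoid

section Comm

variable {k H : Type u} [Field k] [Ring H] [Algebra k H] {V W : QGRep k H}

lemma comm_mul (s t : H ⊗[k] H) : TensorProduct.comm k H H (s * t) =
    TensorProduct.comm k H H s * TensorProduct.comm k H H t :=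
  map_mul (Algebra.TensorProduct.comm k H H) s t

lemma actT_comm (s : H ⊗[k] H) (x : V.carrier ⊗[k] W.carrier) :
    actT W V (TensorProduct.comm k H H s) (TensorProduct.comm k _ _ x) =
      TensorProduct.comm k _ _ (actT V W s x) := by
  induction s using TensorProduct.induction_on with
  | zero => simp
  | add a b ha hb => simp only [map_add, LinearMap.add_apply, ha, hb]
  | tmul a b =>
    induction x using TensorProduct.induction_on with
    | zero => simp
    | add x y hx hy => simp only [map_add, hx, hy]
    | tmul x y => simp

end Comm

section Braiding

variable {k H : Type u} [Field k] [Ring H] [Algebra k H] [QuasitriangularQuantumGroupoid k H]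
variable {U V W X Y Z : QGRep k H}

variable (k H) in
/-- the `R`-matrix -/
noncomputable abbrev Rm : H ⊗[k] H := QuasitriangularQuantumGroupoid.R

variable (k H) in
/-- the element `R₂₁` -/
noncomputable def R21 : H ⊗[k] H := TensorProduct.comm k H H (Rm k H)

lemma R21_mul (h : H) : Δ k h * R21 k H = R21 k H * TensorProduct.comm k H H (Δ k h) := by
  have := congrArg (TensorProduct.comm k H H) (QuasitriangularQuantumGroupoid.Δop_mul_R (k := k) h)
  rw [comm_mul, comm_mul] at this
  rwa [Δop, LinearMap.comp_apply, LinearEquiv.coe_coe, TensorProduct.comm_comm] at this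

/-- `x ↦ R₍₂₎·x₍₂₎ ⊗ R₍₁₎·x₍₁₎` on `V ⊗ₖ W` -/
noncomputable def brFun (V W : QGRep k H) :
    V.carrier ⊗[k] W.carrier →ₗ[k] W.carrier ⊗[k] V.carrier :=
  actT W V (R21 k H) ∘ₗ (TensorProduct.comm k _ _).toLinearMap

lemma brFun_apply (x : V.carrier ⊗[k] W.carrier) :
    brFun V W x = actT W V (R21 k H) (TensorProduct.comm k _ _ x) := rfl

/-- The action of `R₂₁`, as a morphism. -/
noncomputable def brHom (V W : QGRep k H) : tensor V W ⟶ tensor W V :=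
  lift (brFun V W ∘ₗ inc V W) fun h x => by
    simp only [LinearMap.comp_apply, brFun_apply, inc_smul]
    rw [← actT_comm, ← Module.End.mul_apply, ← Module.End.mul_apply, ← map_mul, ← map_mul, R21_mul]

lemma inc_brHom (x : (tensor V W).carrier) :
    inc W V ((brHom V W).lin x) = brFun V W (inc V W x) := inc_lift _ _ x

lemma brHom_bijective (V W : QGRep k H) : Function.Bijective (brHom V W).lin := by
  obtain ⟨r, h1, h2⟩ := QuasitriangularQuantumGroupoid.exists_R_inv (k := k) (H := H)
  set r' := Δ k 1 * r * Δop k 1 with hr'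
  have h3 : Δ k 1 * r' = r' := by
    rw [hr', ← mul_assoc, ← mul_assoc, Δ_one_mul_Δ]
  have h4 : R21 k H * TensorProduct.comm k H H r' = Δ k 1 := by
    rw [R21, ← comm_mul, h1]; simp [Δop]
  constructor
  · have key (x : (tensor V W).carrier) : actT V W r' (TensorProduct.comm k _ _
        (inc W V ((brHom V W).lin x))) = inc V W x := by
      rw [inc_brHom, brFun_apply, R21, actT_comm, TensorProduct.comm_comm, ← Module.End.mul_apply,
        ← map_mul, h2, actT_one_inc]
    intro x y hxy
    apply inc_injective
    rw [← key x, ← key y, hxy]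
  · intro y
    refine ⟨proj V W (actT V W r' (TensorProduct.comm k _ _ (inc W V y))), inc_injective _ _ ?_⟩
    rw [inc_brHom, inc_proj, ← Module.End.mul_apply, ← map_mul, h3, brFun_apply, ← actT_comm,
      TensorProduct.comm_comm, ← Module.End.mul_apply, ← map_mul, h4, actT_one_inc]

/-- The braiding of `Rep(H)`. -/
noncomputable def braid (V W : QGRep k H) : tensor V W ≅ tensor W V :=
  isoMk (LinearEquiv.ofBijective (brHom V W).lin (brHom_bijective V W))

lemma inc_braid (x : (tensor V W).carrier) :
    inc W V ((braid V W).hom.lin x) = brFun V W (inc V W x) := inc_brHom x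

lemma klin_braid : inc W V ∘ₗ klin (braid V W).hom = brFun V W ∘ₗ inc V W :=
  LinearMap.ext fun x => inc_braid x

lemma braid_naturality (f : V ⟶ X) (g : W ⟶ Y) (x : (tensor V W).carrier) :
    (braid X Y).hom.lin ((tensorMap f g).lin x) = (tensorMap g f).lin ((braid V W).hom.lin x) := by
  apply inc_injective
  rw [inc_braid, inc_tensorMap, inc_tensorMap, inc_braid, brFun_apply, brFun_apply, ← actT_map]
  congr 1
  generalize inc V W x = y
  induction y using TensorProduct.induction_on with
  | zero => simp
  | add x y hx hy => simp only [map_add, hx, hy]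
  | tmul x y => simp

lemma incL_associator_inv (x : (tensor U (tensor V W)).carrier) :
    incL U V W ((associator U V W).inv.lin x) =
      (TensorProduct.assoc k _ _ _).symm (incR U V W x) := by
  rw [LinearEquiv.eq_symm_apply, ← incR_associator, ← comp_lin, Iso.inv_hom_id, id_lin]

lemma incL_braid (x : (tensor U (tensor V W)).carrier) :
    incL V W U ((braid U (tensor V W)).hom.lin x) =
      act3 V W U ((Δ k).rTensor H (R21 k H)) (TensorProduct.comm k _ _ (incR U V W x)) := by
  rw [incL, LinearMap.comp_apply, inc_braid, brFun_apply, rTensor_inc_actT, incR,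
    LinearMap.comp_apply]
  congr 1
  generalize inc _ _ x = y
  induction y using TensorProduct.induction_on with
  | zero => simp
  | add x y hx hy => simp only [map_add, hx, hy]
  | tmul x y => simp

lemma incR_braid (x : (tensor (tensor U V) W).carrier) :
    incR W U V ((braid (tensor U V) W).hom.lin x) =
      act₂ (act W) (actT U V) ((Δ k).lTensor H (R21 k H))
        (TensorProduct.comm k _ _ (incL U V W x)) := by
  rw [incR, LinearMap.comp_apply, inc_braid, brFun_apply, lTensor_inc_actT, incL,
    LinearMap.comp_apply]
  congr 1
  generalize inc _ _ x = y
  induction y using TensorProduct.induction_on with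
  | zero => simp
  | add x y hx hy => simp only [map_add, hx, hy]
  | tmul x y => simp

lemma incL_braid_whisker (x : (tensor (tensor U V) W).carrier) :
    incL V U W ((tensorMap (braid U V).hom (𝟙 W)).lin x) =
      (brFun U V).rTensor W.carrier (incL U V W x) := by
  rw [incL, LinearMap.comp_apply, inc_tensorMap, incL, LinearMap.comp_apply, klin_id,
    LinearMap.rTensor_def, LinearMap.rTensor_def, LinearMap.rTensor_def, map_map_apply,
    map_map_apply, klin_braid]

lemma incR_braid_whisker (x : (tensor U (tensor V W)).carrier) :
    incR U W V ((tensorMap (𝟙 U) (braid V W).hom).lin x) =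
      (brFun V W).lTensor U.carrier (incR U V W x) := by
  rw [incR, LinearMap.comp_apply, inc_tensorMap, incR, LinearMap.comp_apply, klin_id,
    LinearMap.lTensor_def, LinearMap.lTensor_def, LinearMap.lTensor_def, map_map_apply,
    map_map_apply, klin_braid]

/-- `R₁₃(s) R₁₂(t)` -/
noncomputable def r13 (s : H ⊗[k] H) : (H ⊗[k] H) ⊗[k] H :=
  TensorProduct.rightComm k H H H (s ⊗ₜ[k] (1 : H))

lemma hexagon_aux (y : (X.carrier ⊗[k] Y.carrier) ⊗[k] Z.carrier) :
    TensorProduct.assoc k _ _ _ (act3 Y Z X ((Δ k).rTensor H (R21 k H))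
      (TensorProduct.comm k _ _ (TensorProduct.assoc k _ _ _ y))) =
    (brFun X Z).lTensor Y.carrier (TensorProduct.assoc k _ _ _
      ((brFun X Y).rTensor Z.carrier y)) := by
  induction y using TensorProduct.induction_on with
  | zero => simp
  | add x y hx hy => simp only [map_add, hx, hy]
  | tmul y z =>
  induction y using TensorProduct.induction_on with
  | zero => simp
  | add x y hx hy => simp only [TensorProduct.add_tmul, map_add, hx, hy]
  | tmul x y =>
  let M' : (H ⊗[k] H) ⊗[k] H →ₗ[k] Y.carrier ⊗[k] (Z.carrier ⊗[k] X.carrier) :=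
    TensorProduct.map ((act Y).toLinearMap.flip y)
      (TensorProduct.map ((act Z).toLinearMap.flip z) ((act X).toLinearMap.flip x)) ∘ₗ
      (TensorProduct.comm k H H).toLinearMap.lTensor H ∘ₗ
      (TensorProduct.leftComm k H H H).toLinearMap ∘ₗ
      (TensorProduct.assoc k H H H).toLinearMap
  have hM (a b c : H) : M' ((a ⊗ₜ b) ⊗ₜ c) = (b • y) ⊗ₜ ((c • z) ⊗ₜ (a • x)) := by simp [M']
  have e1 (s : H ⊗[k] H) : TensorProduct.assoc k _ _ _ (act3 Y Z X ((Δ k).rTensor H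
      (TensorProduct.comm k H H s)) ((y ⊗ₜ z) ⊗ₜ x)) =
      M' ((TensorProduct.assoc k H H H).symm ((Δ k).lTensor H s)) := by
    induction s using TensorProduct.induction_on with
    | zero => simp
    | add a b ha hb => simp only [map_add, LinearMap.add_apply, ha, hb]
    | tmul a b =>
      simp only [TensorProduct.comm_tmul, LinearMap.rTensor_tmul, LinearMap.lTensor_tmul]
      induction Δ k b using TensorProduct.induction_on with
      | zero => simp
      | add u v hu hv =>
        simp only [TensorProduct.add_tmul, TensorProduct.tmul_add, map_add, LinearMap.add_apply,
          hu, hv]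
      | tmul u v => simp [hM]
  have e2 (s t : H ⊗[k] H) : M' (r13 s * (t ⊗ₜ[k] (1 : H))) =
      (actT Z X (TensorProduct.comm k H H s) ∘ₗ (TensorProduct.comm k _ _).toLinearMap).lTensor
        Y.carrier (TensorProduct.assoc k _ _ _
          ((actT Y X (TensorProduct.comm k H H t) (y ⊗ₜ x)) ⊗ₜ z)) := by
    induction t using TensorProduct.induction_on with
    | zero => simp
    | add a b ha hb =>
      simp only [map_add, LinearMap.add_apply, TensorProduct.add_tmul, mul_add, ha, hb]
    | tmul c d =>
      induction s using TensorProduct.induction_on with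
      | zero => simp [r13]
      | add a b ha hb =>
        have : r13 (a + b) = r13 a + r13 b := by simp [r13, TensorProduct.add_tmul]
        rw [this, add_mul, map_add, ha, hb, map_add, map_add, LinearMap.add_comp,
          LinearMap.lTensor_add, LinearMap.add_apply]
      | tmul a b => simp [r13, hM, mul_smul]
  have e3 := QuasitriangularQuantumGroupoid.lTensor_R (k := k) (H := H)
  simp only [TensorProduct.assoc_tmul, TensorProduct.comm_tmul]
  rw [R21, e1, e3, ← r13, e2]
  rfl

lemma hexagon_aux' (y : X.carrier ⊗[k] (Y.carrier ⊗[k] Z.carrier)) :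
    (TensorProduct.assoc k _ _ _).symm (act₂ (act Z) (actT X Y) ((Δ k).lTensor H (R21 k H))
      (TensorProduct.comm k _ _ ((TensorProduct.assoc k _ _ _).symm y))) =
    (brFun X Z).rTensor Y.carrier ((TensorProduct.assoc k _ _ _).symm
      ((brFun Y Z).lTensor X.carrier y)) := by
  induction y using TensorProduct.induction_on with
  | zero => simp
  | add x y hx hy => simp only [map_add, hx, hy]
  | tmul x y =>
  induction y using TensorProduct.induction_on with
  | zero => simp
  | add x y hx hy => simp only [TensorProduct.tmul_add, map_add, hx, hy]
  | tmul y z =>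
  let M : (H ⊗[k] H) ⊗[k] H →ₗ[k] (Z.carrier ⊗[k] X.carrier) ⊗[k] Y.carrier :=
    TensorProduct.map
      (TensorProduct.map ((act Z).toLinearMap.flip z) ((act X).toLinearMap.flip x))
      ((act Y).toLinearMap.flip y) ∘ₗ
      (TensorProduct.comm k H H).toLinearMap.rTensor H ∘ₗ
      (TensorProduct.rightComm k H H H).toLinearMap
  have hM (a b c : H) : M ((a ⊗ₜ b) ⊗ₜ c) = ((c • z) ⊗ₜ (a • x)) ⊗ₜ (b • y) := by simp [M]
  have e1 (s : H ⊗[k] H) : (TensorProduct.assoc k _ _ _).symm (act₂ (act Z) (actT X Y)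
      ((Δ k).lTensor H (TensorProduct.comm k H H s)) (z ⊗ₜ (x ⊗ₜ y))) =
      M ((Δ k).rTensor H s) := by
    induction s using TensorProduct.induction_on with
    | zero => simp
    | add a b ha hb => simp only [map_add, LinearMap.add_apply, ha, hb]
    | tmul a b =>
      simp only [TensorProduct.comm_tmul, LinearMap.rTensor_tmul, LinearMap.lTensor_tmul]
      induction Δ k a using TensorProduct.induction_on with
      | zero => simp
      | add u v hu hv =>
        simp only [TensorProduct.add_tmul, TensorProduct.tmul_add, map_add, LinearMap.add_apply,
          hu, hv]
      | tmul u v => simp [hM]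
  have e2 (s t : H ⊗[k] H) :
      M (r13 s * (TensorProduct.assoc k H H H).symm ((1 : H) ⊗ₜ[k] t)) =
      (actT Z X (TensorProduct.comm k H H s) ∘ₗ (TensorProduct.comm k _ _).toLinearMap).rTensor
        Y.carrier ((TensorProduct.assoc k _ _ _).symm
          (x ⊗ₜ (actT Z Y (TensorProduct.comm k H H t) (z ⊗ₜ y)))) := by
    induction t using TensorProduct.induction_on with
    | zero => simp
    | add a b ha hb =>
      simp only [map_add, LinearMap.add_apply, TensorProduct.tmul_add, mul_add, ha, hb]
    | tmul c d =>
      induction s using TensorProduct.induction_on with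
      | zero => simp [r13]
      | add a b ha hb =>
        have : r13 (a + b) = r13 a + r13 b := by simp [r13, TensorProduct.add_tmul]
        rw [this, add_mul, map_add, ha, hb, map_add, map_add, LinearMap.add_comp,
          LinearMap.rTensor_add, LinearMap.add_apply]
      | tmul a b => simp [r13, hM, mul_smul]
  have e3 := QuasitriangularQuantumGroupoid.rTensor_R (k := k) (H := H)
  simp only [TensorProduct.assoc_symm_tmul, TensorProduct.comm_tmul]
  rw [R21, e1, e3, ← r13, e2]
  rfl

noncomputable instance : BraidedCategory (QGRep k H) where
  braiding := braid
  braiding_naturality_right X _ _ f := hom_ext fun x => braid_naturality (𝟙 X) f x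
  braiding_naturality_left f Z := hom_ext fun x => braid_naturality f (𝟙 Z) x
  hexagon_forward X Y Z := hom_ext fun x => incR_injective _ _ _ (by
    change incR Y Z X ((associator Y Z X).hom.lin ((braid X (tensor Y Z)).hom.lin
      ((associator X Y Z).hom.lin x))) =
      incR Y Z X ((tensorMap (𝟙 Y) (braid X Z).hom).lin ((associator Y X Z).hom.lin
        ((tensorMap (braid X Y).hom (𝟙 Z)).lin x)))
    rw [incR_associator, incL_braid, incR_associator, incR_braid_whisker, incR_associator,
      incL_braid_whisker, hexagon_aux])
  hexagon_reverse X Y Z := hom_ext fun x => incL_injective _ _ _ (by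
    change incL Z X Y ((associator Z X Y).inv.lin ((braid (tensor X Y) Z).hom.lin
      ((associator X Y Z).inv.lin x))) =
      incL Z X Y ((tensorMap (braid X Z).hom (𝟙 Y)).lin ((associator X Z Y).inv.lin
        ((tensorMap (𝟙 X) (braid Y Z).hom).lin x)))
    rw [incL_associator_inv, incR_braid, incL_associator_inv, incL_braid_whisker,
      incL_associator_inv, incR_braid_whisker, hexagon_aux'])

end Braiding

section Duality

variable {k H : Type u} [Field k] [Ring H] [Algebra k H] [QuantumGroupoid k H]

/-- `(h·φ)(v) = φ(S(h)·v)` on `V* = Hom_k(V, k)` -/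
@[reducible] noncomputable def dualModule (V : QGRep k H) : Module H (Module.Dual k V.carrier) where
  smul h φ := φ ∘ₗ act V (S k h)
  one_smul φ := by
    change φ ∘ₗ act V (S k 1) = φ
    rw [show S k (1 : H) = 1 from antipode_one, map_one]; rfl
  mul_smul a b φ := by
    change φ ∘ₗ act V (S k (a * b)) = (φ ∘ₗ act V (S k b)) ∘ₗ act V (S k a)
    rw [show S k (a * b) = S k b * S k a from antipode_mul a b, map_mul]; rfl
  smul_zero a := LinearMap.zero_comp _
  smul_add a φ ψ := LinearMap.add_comp _ _ _
  add_smul a b φ := by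
    change φ ∘ₗ act V (S k (a + b)) = φ ∘ₗ act V (S k a) + φ ∘ₗ act V (S k b)
    rw [map_add, map_add, LinearMap.comp_add]
  zero_smul φ := by
    change φ ∘ₗ act V (S k 0) = 0
    rw [map_zero, map_zero, LinearMap.comp_zero]

/-- The dual object `V*`. -/
noncomputable def dual (V : QGRep k H) : QGRep k H :=
  letI := dualModule V
  { carrier := Module.Dual k V.carrier
    tower := ⟨fun c h φ => by
      change φ ∘ₗ act V (S k (c • h)) = c • (φ ∘ₗ act V (S k h))
      rw [map_smul, map_smul, LinearMap.comp_smul]⟩ }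

variable (V : QGRep k H)

/-- elements of `V*` as functionals -/
noncomputable def dualEquiv : (dual V).carrier ≃ₗ[k] Module.Dual k V.carrier :=
  LinearEquiv.refl k (Module.Dual k V.carrier)

@[simp] lemma dualEquiv_smul (h : H) (φ : (dual V).carrier) (v : V.carrier) :
    dualEquiv V (h • φ) v = dualEquiv V φ (S k h • v) := rfl

/-- the identification `V ⊗ V* ≅ End_k(V)` -/
noncomputable def opEquiv : V.carrier ⊗[k] (dual V).carrier ≃ₗ[k] Module.End k V.carrier :=
  TensorProduct.comm k _ _ ≪≫ₗ
    (dualTensorHomEquiv k V.carrier V.carrier :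
      Module.Dual k V.carrier ⊗[k] V.carrier ≃ₗ[k] (V.carrier →ₗ[k] V.carrier))

@[simp] lemma opEquiv_tmul (v w : V.carrier) (φ : (dual V).carrier) :
    opEquiv V (v ⊗ₜ φ) w = dualEquiv V φ w • v := rfl

/-- `x₁ ⊗ x₂ ↦ x₁ T S(x₂)` -/
noncomputable def sw (T : Module.End k V.carrier) : H ⊗[k] H →ₗ[k] Module.End k V.carrier :=
  LinearMap.mul' k _ ∘ₗ TensorProduct.map (LinearMap.mulRight k T ∘ₗ (act V).toLinearMap)
    ((act V).toLinearMap ∘ₗ S k)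

lemma opEquiv_act (s : H ⊗[k] H) (x : V.carrier ⊗[k] (dual V).carrier) :
    opEquiv V (actT V (dual V) s x) = sw V (opEquiv V x) s := by
  induction s using TensorProduct.induction_on with
  | zero => simp
  | add a b ha hb => simp only [map_add, LinearMap.add_apply, ha, hb]
  | tmul a b =>
    induction x using TensorProduct.induction_on with
    | zero => simp [sw]
    | add x y hx hy =>
      rw [map_add, map_add, hx, hy, map_add]
      simp [sw, mul_add, add_mul]
    | tmul v φ =>
      ext w
      simp [sw, Module.End.mul_apply]

/-- the canonical element `∑ fᵢ ⊗ ξⁱ` of `V ⊗ₖ V*`, for dual bases `(fᵢ)`, `(ξⁱ)` -/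
noncomputable def canon : V.carrier ⊗[k] (dual V).carrier := coevaluation k V.carrier 1

lemma opEquiv_canon : opEquiv V (canon V) = 1 := by
  ext w
  rw [canon, coevaluation_apply_one]
  change opEquiv V (∑ i, Module.Basis.ofVectorSpace k V.carrier i ⊗ₜ
    ((dualEquiv V).symm ((Module.Basis.ofVectorSpace k V.carrier).coord i))) w = w
  rw [map_sum, LinearMap.sum_apply]
  simp only [opEquiv_tmul, LinearEquiv.apply_symm_apply]
  exact (Module.Basis.ofVectorSpace k V.carrier).sum_repr w

/-- `z ↦ z · ∑ fᵢ ⊗ ξⁱ` -/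
noncomputable def coevFun : (unitObj k H).carrier →ₗ[k] V.carrier ⊗[k] (dual V).carrier :=
  (LinearMap.applyₗ (canon V)) ∘ₗ (actT V (dual V)).toLinearMap ∘ₗ Δ k ∘ₗ uinc

lemma coevFun_apply (z : (unitObj k H).carrier) :
    coevFun V z = actT V (dual V) (Δ k (uinc z)) (canon V) := rfl

lemma opEquiv_Δ (h : H) : opEquiv V (actT V (dual V) (Δ k h) (canon V)) = act V (εt k h) := by
  rw [opEquiv_act, opEquiv_canon]
  change _ = act V (LinearMap.mul' k H ((S k).lTensor H (Δ k h)))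
  induction Δ k h using TensorProduct.induction_on with
  | zero => simp
  | add a b ha hb => simp only [map_add, ha, hb]
  | tmul a b => simp [sw]

/-- The coevaluation `b_V : H_t → V ⊗ V*`, `z ↦ z · ∑ fᵢ ⊗ ξⁱ`. -/
noncomputable def coevHom : unitObj k H ⟶ tensor V (dual V) :=
  lift (coevFun V) fun h z => (opEquiv V).injective (by
    rw [coevFun_apply, coevFun_apply, ← Module.End.mul_apply, ← map_mul, ← Δ_mul, opEquiv_Δ,
      opEquiv_Δ, uinc_smul, εt_εt])

lemma inc_coevHom (z : (unitObj k H).carrier) :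
    inc V (dual V) ((coevHom V).lin z) = coevFun V z := inc_lift _ _ z

lemma opEquiv_coevFun (z : (unitObj k H).carrier) : opEquiv V (coevFun V z) = act V (uinc z) := by
  rw [coevFun_apply, opEquiv_Δ, εt_uinc]

/-- `φ ⊗ v ↦ (h ↦ φ(h·v))` -/
noncomputable def matrixCoeff : (dual V).carrier ⊗[k] V.carrier →ₗ[k] Module.Dual k H :=
  TensorProduct.lift (LinearMap.mk₂ k
    (fun φ v => dualEquiv V φ ∘ₗ ((act V).toLinearMap.flip v))
    (by intros; rw [map_add, LinearMap.add_comp])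
    (by intros; rw [map_smul, LinearMap.smul_comp])
    (by intros; rw [map_add, LinearMap.comp_add])
    (by intros; rw [map_smul, LinearMap.comp_smul]))

@[simp] lemma matrixCoeff_tmul (φ : (dual V).carrier) (v : V.carrier) (h : H) :
    matrixCoeff V (φ ⊗ₜ v) h = dualEquiv V φ (h • v) := rfl

/-- `φ ⊗ v ↦ φ(1₍₁₎·v) 1₍₂₎` -/
noncomputable def evFun : (dual V).carrier ⊗[k] V.carrier →ₗ[k] (unitObj k H).carrier :=
  uproj ∘ₗ (TensorProduct.lid k H).toLinearMap ∘ₗ LinearMap.applyₗ (Δ k (1 : H)) ∘ₗ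
    LinearMap.rTensorHom H ∘ₗ matrixCoeff V

lemma uinc_evFun (x : (dual V).carrier ⊗[k] V.carrier) : uinc (evFun V x) =
    TensorProduct.lid k H ((matrixCoeff V x).rTensor H (Δ k (1 : H))) := by
  have h (s : H ⊗[k] H) : εt k (TensorProduct.lid k H ((matrixCoeff V x).rTensor H s)) =
      TensorProduct.lid k H ((matrixCoeff V x).rTensor H ((εt k).lTensor H s)) := by
    induction s using TensorProduct.induction_on with
    | zero => simp
    | add a b ha hb => simp only [map_add, ha, hb]
    | tmul a b => simp
  change εt k (TensorProduct.lid k H ((matrixCoeff V x).rTensor H (Δ k (1 : H)))) = _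
  rw [h, lTensor_εt_one]

lemma ε_evFun (x : (dual V).carrier ⊗[k] V.carrier) : ε k (uinc (evFun V x)) =
    matrixCoeff V x 1 := by
  have h (s : H ⊗[k] H) : ε k (TensorProduct.lid k H ((matrixCoeff V x).rTensor H s)) =
      matrixCoeff V x (TensorProduct.rid k H ((ε k).lTensor H s)) := by
    induction s using TensorProduct.induction_on with
    | zero => simp
    | add a b ha hb => simp only [map_add, ha, hb]
    | tmul a b => simp [mul_comm]
  rw [uinc_evFun, h, counit_rid]

lemma evFun_Δ (h : H) (x : (dual V).carrier ⊗[k] V.carrier) :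
    evFun V (actT (dual V) V (Δ k h) x) = h • evFun V x := by
  apply uinc_injective
  rw [uinc_smul, uinc_evFun, uinc_evFun]
  have e1 (s t : H ⊗[k] H) : TensorProduct.lid k H
      ((matrixCoeff V (actT (dual V) V s x)).rTensor H t) =
      TensorProduct.lid k H ((matrixCoeff V x).rTensor H (sandwich t s)) := by
    induction s using TensorProduct.induction_on with
    | zero => simp
    | add a b ha hb =>
      simp only [map_add, LinearMap.add_apply, LinearMap.rTensor_add, ha, hb]
    | tmul a b =>
      rw [sandwich_tmul]
      induction t using TensorProduct.induction_on with
      | zero => simp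
      | add u v hu hv => simp only [map_add, mul_add, add_mul, hu, hv]
      | tmul c d =>
        simp only [Algebra.TensorProduct.tmul_mul_tmul, one_mul, mul_one, LinearMap.rTensor_tmul,
          TensorProduct.lid_tmul]
        congr 1
        induction x using TensorProduct.induction_on with
        | zero => simp
        | add u v hu hv => simp only [map_add, LinearMap.add_apply, hu, hv]
        | tmul φ v => simp [mul_smul]
  have e2 (t : H ⊗[k] H) : εt k (h * TensorProduct.lid k H ((matrixCoeff V x).rTensor H t)) =
      TensorProduct.lid k H ((matrixCoeff V x).rTensor H
        ((εt k).lTensor H (((1 : H) ⊗ₜ[k] h) * t))) := by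
    induction t using TensorProduct.induction_on with
    | zero => simp
    | add u v hu hv => simp only [map_add, mul_add, hu, hv]
    | tmul c d => simp
  rw [e1, ← lTensor_εt_mul_one, e2]

/-- The evaluation `d_V : V* ⊗ V → H_t`, `φ ⊗ v ↦ φ(1₍₁₎·v) 1₍₂₎`. -/
noncomputable def evHom : tensor (dual V) V ⟶ unitObj k H where
  lin :=
    { toFun := fun x => evFun V (inc _ _ x)
      map_add' := fun x y => by rw [map_add, map_add]
      map_smul' := fun h x => by rw [inc_smul, evFun_Δ]; rfl }

lemma klin_evHom : klin (evHom V) = evFun V ∘ₗ inc _ _ := rfl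

lemma klin_coevHom : inc _ _ ∘ₗ klin (coevHom V) = coevFun V :=
  LinearMap.ext fun z => inc_coevHom V z

lemma zigzag₁ (x : (tensor (unitObj k H) V).carrier) :
    (rightUnitor V).hom.lin ((tensorMap (𝟙 V) (evHom V)).lin ((associator V (dual V) V).hom.lin
      ((tensorMap (coevHom V) (𝟙 V)).lin x))) = (leftUnitor V).hom.lin x := by
  rw [rightUnitor_lin, inc_tensorMap, klin_evHom, klin_id]
  have h1 (y : (tensor V (tensor (dual V) V)).carrier) :
      TensorProduct.map LinearMap.id (evFun V ∘ₗ inc _ _) (inc V (tensor (dual V) V) y) =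
        (evFun V).lTensor _ (incR V (dual V) V y) := by
    rw [incR, LinearMap.comp_apply, LinearMap.lTensor_def, LinearMap.lTensor_def, map_map_apply]
    rfl
  have h2 : incL V (dual V) V ((tensorMap (coevHom V) (𝟙 V)).lin x) =
      (coevFun V).rTensor _ (inc _ _ x) := by
    rw [incL, LinearMap.comp_apply, inc_tensorMap, klin_id, LinearMap.rTensor_def,
      LinearMap.rTensor_def, map_map_apply, klin_coevHom]
    rfl
  rw [h1, incR_associator, h2]
  rw [leftUnitor_lin, epsL_inc, leftFun, LinearMap.comp_apply]
  generalize inc _ _ x = y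
  induction y using TensorProduct.induction_on with
  | zero => simp
  | add x y hx hy => simp only [map_add, hx, hy]
  | tmul z v =>
    simp only [LinearMap.rTensor_tmul, TensorProduct.lift.tmul, LinearMap.comp_apply,
      AlgHom.toLinearMap_apply]
    rw [← opEquiv_coevFun]
    generalize coevFun V z = t
    induction t using TensorProduct.induction_on with
    | zero => simp
    | add x y hx hy => simp only [map_add, TensorProduct.add_tmul, LinearMap.add_apply, hx, hy]
    | tmul w φ => simp [ε_evFun]

lemma zigzag₂ (φ : (dual V).carrier) :
    (leftUnitor (dual V)).hom.lin ((tensorMap (evHom V) (𝟙 (dual V))).lin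
      ((associator (dual V) V (dual V)).inv.lin ((tensorMap (𝟙 (dual V)) (coevHom V)).lin
        ((rightUnitor (dual V)).inv.lin φ)))) = φ := by
  rw [leftUnitor_lin, inc_tensorMap, klin_evHom, klin_id]
  have h1 (y : (tensor (tensor (dual V) V) (dual V)).carrier) :
      TensorProduct.map (evFun V ∘ₗ inc _ _) LinearMap.id (inc (tensor (dual V) V) (dual V) y) =
        (evFun V).rTensor _ (incL (dual V) V (dual V) y) := by
    rw [incL, LinearMap.comp_apply, LinearMap.rTensor_def, LinearMap.rTensor_def, map_map_apply]
    rfl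
  have h2 (x) : incR (dual V) V (dual V) ((tensorMap (𝟙 (dual V)) (coevHom V)).lin x) =
      (coevFun V).lTensor _ (inc _ _ x) := by
    rw [incR, LinearMap.comp_apply, inc_tensorMap, klin_id, LinearMap.lTensor_def,
      LinearMap.lTensor_def, map_map_apply, klin_coevHom]
    rfl
  have h3 (y : (tensor (dual V) (tensor V (dual V))).carrier) :
      incL (dual V) V (dual V) ((associator (dual V) V (dual V)).inv.lin y) =
      (TensorProduct.assoc k _ _ _).symm (incR (dual V) V (dual V) y) := by
    rw [LinearEquiv.eq_symm_apply, ← incR_associator, ← comp_lin, Iso.inv_hom_id, id_lin]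
  rw [h1, h3, h2, rightUnitor_inv_lin, inc_proj]
  -- contract
  let K : (dual V).carrier ⊗[k] (unitObj k H).carrier →ₗ[k] (dual V).carrier :=
    epsL (dual V) ∘ₗ (evFun V).rTensor _ ∘ₗ (TensorProduct.assoc k _ _ _).symm.toLinearMap ∘ₗ
      (coevFun V).lTensor _
  have hK (ψ : (dual V).carrier) (z : (unitObj k H).carrier) (v : V.carrier) :
      dualEquiv V (K (ψ ⊗ₜ z)) v = dualEquiv V ψ (uinc z • v) := by
    rw [show uinc z • v = act V (uinc z) v from rfl, ← opEquiv_coevFun]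
    simp only [K, LinearMap.comp_apply, LinearMap.lTensor_tmul]
    generalize coevFun V z = t
    induction t using TensorProduct.induction_on with
    | zero => simp
    | add x y hx hy => 
      simp only [map_add, TensorProduct.tmul_add, LinearMap.add_apply, hx, hy]
    | tmul w φ => simp [ε_evFun, mul_comm]
  change K _ = φ
  apply (dualEquiv V).injective
  ext v
  have h4 (s : H ⊗[k] H) : dualEquiv V (K (actT (dual V) (unitObj k H) s
      (φ ⊗ₜ uproj (k := k) (1 : H)))) v =
      dualEquiv V φ (LinearMap.mul' k H ((S k).rTensor H ((εt k).lTensor H s)) • v) := by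
    induction s using TensorProduct.induction_on with
    | zero => simp
    | add a b ha hb => simp only [map_add, LinearMap.add_apply, add_smul, ha, hb]
    | tmul a b =>
      rw [act₂_tmul, hK]
      simp [mul_smul, εt_one]
  rw [h4, lTensor_εt_one]
  change dualEquiv V φ (εs (k := k) (1 : H) • v) = _
  rw [εs_one, one_smul]

noncomputable instance : RightRigidCategory (QGRep k H) where
  rightDual V :=
    { rightDual := dual V
      exact :=
        { coevaluation' := coevHom V
          evaluation' := evHom V
          coevaluation_evaluation' := by
            rw [← Category.assoc, Iso.eq_comp_inv, ← Iso.inv_comp_eq_id]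
            exact hom_ext fun φ => zigzag₂ V φ
          evaluation_coevaluation' := by
            rw [← Category.assoc, Iso.eq_comp_inv]
            exact hom_ext fun x => zigzag₁ V x } }

end Duality

section Ribbon

variable {k H : Type u} [Field k] [Ring H] [Algebra k H] [RibbonQuantumGroupoid k H]

variable (k H) in
/-- the ribbon element -/
noncomputable abbrev rib : H := RibbonQuantumGroupoid.ν k

/-- multiplication by the ribbon element -/
noncomputable def twistHom (V : QGRep k H) : V ⟶ V where
  lin :=
    { toFun := fun v => rib k H • v
      map_add' := fun x y => smul_add _ _ _
      map_smul' := fun h x => by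
        rw [RingHom.id_apply, ← mul_smul, ← mul_smul, RibbonQuantumGroupoid.ν_central] }

lemma twistHom_bijective (V : QGRep k H) : Function.Bijective (twistHom V).lin := by
  obtain ⟨w, hw⟩ := RibbonQuantumGroupoid.isUnit_ν (k := k) (H := H)
  change Function.Bijective fun v : V.carrier => rib k H • v
  rw [show rib k H = (w : H) from hw.symm]
  exact MulAction.bijective w

/-- The twist of `Rep(H)`. -/
noncomputable def twistIso (V : QGRep k H) : V ≅ V :=
  isoMk (LinearEquiv.ofBijective (twistHom V).lin (twistHom_bijective V))

lemma twistIso_lin (V : QGRep k H) (v : V.carrier) : (twistIso V).hom.lin v = rib k H • v := rfl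

noncomputable instance : RibbonCategory (QGRep k H) where
  twist := twistIso
  twist_naturality f := hom_ext fun x => by
    rw [comp_lin, comp_lin, twistIso_lin, twistIso_lin, map_smul]
  twist_tensor V W := hom_ext fun x => inc_injective _ _ (by
    change inc V W (rib k H • x) = inc V W ((braid W V).hom.lin ((braid V W).hom.lin
      ((tensorMap (twistIso V).hom (twistIso W).hom).lin x)))
    rw [inc_braid, inc_braid, inc_tensorMap, inc_smul, brFun_apply, brFun_apply]
    have h0 (y : V.carrier ⊗[k] W.carrier) : actT V W (R21 k H) (TensorProduct.comm k _ _
        (actT W V (R21 k H) (TensorProduct.comm k _ _ y))) =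
        actT V W (R21 k H) (actT V W (Rm k H) y) := by
      conv_lhs => rw [R21, actT_comm (V := V) (W := W) (Rm k H) y, TensorProduct.comm_comm]
      rfl
    rw [h0]
    have h1 : TensorProduct.map (klin (twistIso V).hom) (klin (twistIso W).hom) (inc V W x) =
        actT V W (rib k H ⊗ₜ[k] rib k H) (inc V W x) := by
      rw [act₂_tmul']; rfl
    rw [h1, ← Module.End.mul_apply, ← Module.End.mul_apply, ← map_mul, ← map_mul]
    rw [show Δ k (rib k H) = _ from RibbonQuantumGroupoid.Δ_ν, R21])
  twist_dual V := hom_ext fun z => inc_injective _ _ ((opEquiv V).injective (by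
    change opEquiv V (inc _ _ ((tensorMap (twistIso V).hom (𝟙 (dual V))).lin
      ((coevHom V).lin z))) =
      opEquiv V (inc _ _ ((tensorMap (𝟙 V) (twistIso (dual V)).hom).lin ((coevHom V).lin z)))
    rw [inc_tensorMap, inc_tensorMap, inc_coevHom, klin_id, klin_id]
    have h1 (y : V.carrier ⊗[k] (dual V).carrier) :
        TensorProduct.map (klin (twistIso V).hom) LinearMap.id y =
        actT V (dual V) (rib k H ⊗ₜ[k] 1) y := by
      rw [act₂_tmul', map_one]; rfl
    have h2 (y : V.carrier ⊗[k] (dual V).carrier) :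
        TensorProduct.map LinearMap.id (klin (twistIso (dual V)).hom) y =
        actT V (dual V) (1 ⊗ₜ[k] rib k H) y := by
      rw [act₂_tmul', map_one]; rfl
    rw [h1, h2, opEquiv_act, opEquiv_act, opEquiv_coevFun]
    have hS : S k (rib k H) = rib k H := RibbonQuantumGroupoid.S_ν
    have hS1 : S k (1 : H) = 1 := antipode_one
    simp only [sw, LinearMap.comp_apply, TensorProduct.map_tmul, LinearMap.mul'_apply,
      AlgHom.toLinearMap_apply, LinearMap.mulRight_apply, hS, hS1, map_one, mul_one, one_mul]
    rw [← map_mul, ← map_mul, show rib k H * uinc z = uinc z * rib k H from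
      RibbonQuantumGroupoid.ν_central _]))

end Ribbon
end QGRep

section Trace

variable {C : Type*} [Category C] [MonoidalCategory C] [BraidedCategory C]
  [RightRigidCategory C] [RibbonCategory C]

/-- The quantum trace `d_X ∘ c_{X,X*} ∘ ((θ_X ∘ f) ⊗ id) ∘ b_X` of an endomorphism. -/
noncomputable def qtr {X : C} (f : X ⟶ X) : 𝟙_ C ⟶ 𝟙_ C :=
  η_ X Xᘁ ≫ (f ≫ (RibbonCategory.twist X).hom) ▷ Xᘁ ≫ (β_ X Xᘁ).hom ≫ ε_ X Xᘁ

variable [Preadditive C]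

/-- A morphism `f : X ⟶ Y` is negligible if `tr(f ∘ g) = 0` for all `g : Y ⟶ X`. -/
def IsNegligible {X Y : C} (f : X ⟶ Y) : Prop := ∀ g : Y ⟶ X, qtr (g ≫ f) = 0

/-- An object is negligible if all its endomorphisms have trace zero. -/
def IsNegligibleObj (X : C) : Prop := ∀ f : X ⟶ X, qtr f = 0

/-- `∑ r, f_r ∘ g_r` differs from the identity of `X` by a negligible morphism, for some morphisms
`f_r : V_{s(r)} ⟶ X` and `g_r : X ⟶ V_{s(r)}`. -/
def Quasidominates {I : Type*} (V : I → C) (X : C) : Prop :=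
  ∃ (n : ℕ) (s : Fin n → I) (f : ∀ r, V (s r) ⟶ X) (g : ∀ r, X ⟶ V (s r)),
    IsNegligible (𝟙 X - ∑ r, g r ≫ f r)

/-- The identity of `X` equals `∑ r, f_r ∘ g_r` for some morphisms
`f_r : V_{s(r)} ⟶ X` and `g_r : X ⟶ V_{s(r)}`. -/
def Dominates {I : Type*} (V : I → C) (X : C) : Prop :=
  ∃ (n : ℕ) (s : Fin n → I) (f : ∀ r, V (s r) ⟶ X) (g : ∀ r, X ⟶ V (s r)),
    𝟙 X = ∑ r, g r ≫ f r

variable (k : Type*) [Field k] [Linear k C]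

/-- Every endomorphism of `X` is multiplication by a unique element of `k`. -/
def IsSimpleObj (X : C) : Prop := Function.Bijective fun c : k => c • 𝟙 X

variable {I : Type*} [Fintype I] [DecidableEq I]

/-- A finite family of simple objects of a ribbon category which contains the unit object, is
closed under duality up to isomorphism, and for which the square matrix
`S_{ij} = tr(c_{V_i,V_j} ∘ c_{V_j,V_i})`, with `End(𝟙) = k`, is invertible over `k`. -/
structure IsModularFamily (V : I → C) : Prop where
  simple : ∀ i, IsSimpleObj k (V i)
  unit : ∃ i, V i = 𝟙_ C
  dual : ∀ i, ∃ j, Nonempty (V j ≅ (V i)ᘁ)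
  smatrix : ∃ S : Matrix I I k, (∀ i j, S i j • 𝟙 (𝟙_ C) =
    qtr ((β_ (V j) (V i)).hom ≫ (β_ (V i) (V j)).hom)) ∧ IsUnit S

variable [MonoidalPreadditive C] [MonoidalLinear k C]

/-- `(C, V)` is a quasimodular category. -/
structure IsQuasimodular (V : I → C) : Prop extends IsModularFamily k V where
  quasidominates : ∀ X : C, Quasidominates V X

/-- `(C, V)` is a modular category. -/
structure IsModular (V : I → C) : Prop extends IsModularFamily k V where
  dominates : ∀ X : C, Dominates V X

end Trace

section Purification

open RibbonCategory

section Ideal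

lemma exists_coev {C : Type*} [Category C] [MonoidalCategory C] [RightRigidCategory C] {Y D : C}
     (u : 𝟙_ C ⟶ Y ⊗ Dᘁ) : ∃ t : D ⟶ Y, u = η_ D Dᘁ ≫ t ▷ Dᘁ := by
  refine ⟨(λ_ _).inv ≫ (tensorRightHomEquiv (𝟙_ C) D Dᘁ Y).symm u, ?_⟩
  conv_lhs => rw [← (tensorRightHomEquiv (𝟙_ C) D Dᘁ Y).apply_symm_apply u]
  generalize (tensorRightHomEquiv (𝟙_ C) D Dᘁ Y).symm u = v
  simp [tensorRightHomEquiv, unitors_equal]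

variable {C : Type*} [Category C] [MonoidalCategory C] [BraidedCategory C]
  [RightRigidCategory C] [RibbonCategory C]

/-- the pairing `Z ⊗ Z* ⟶ 𝟙` occurring in the quantum trace -/
noncomputable def tev (Z : C) : Z ⊗ Zᘁ ⟶ 𝟙_ C :=
  (twist Z).hom ▷ Zᘁ ≫ (β_ Z Zᘁ).hom ≫ ε_ Z Zᘁ

lemma qtr_eq {Z : C} (f : Z ⟶ Z) : qtr f = η_ Z Zᘁ ≫ f ▷ Zᘁ ≫ tev Z := by
  simp [qtr, tev]

lemma exists_tev {Z D : C} (φ : Z ⊗ D ⟶ 𝟙_ C) : ∃ t : D ⟶ Zᘁ, φ = Z ◁ t ≫ tev Z := by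
  let ψ : D ⊗ Z ⟶ 𝟙_ C := (β_ Z D).inv ≫ (twist Z).inv ▷ D ≫ φ
  refine ⟨tensorRightHomEquiv D Z Zᘁ (𝟙_ C) ψ ≫ (λ_ _).hom, ?_⟩
  have h1 : (tensorRightHomEquiv D Z Zᘁ (𝟙_ C) ψ ≫ (λ_ _).hom) ▷ Z ≫ ε_ Z Zᘁ = ψ := by
    conv_rhs => rw [← (tensorRightHomEquiv D Z Zᘁ (𝟙_ C)).symm_apply_apply ψ]
    generalize tensorRightHomEquiv D Z Zᘁ (𝟙_ C) ψ = u
    simp [tensorRightHomEquiv, ← unitors_equal]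
  rw [tev, whisker_exchange_assoc, BraidedCategory.braiding_naturality_right_assoc, h1]
  simp [ψ]

variable [Preadditive C]

lemma isNegligible_iff {Y Z : C} (f : Y ⟶ Z) : IsNegligible f ↔
    ∀ (D : C) (u : 𝟙_ C ⟶ Y ⊗ D) (φ : Z ⊗ D ⟶ 𝟙_ C), u ≫ f ▷ D ≫ φ = 0 := by
  constructor
  · intro h D u φ
    obtain ⟨t, rfl⟩ := exists_tev φ
    obtain ⟨g, hg⟩ := exists_coev (u ≫ Y ◁ t)
    rw [← whisker_exchange_assoc, ← Category.assoc, hg, ← h g, qtr_eq, comp_whiskerRight,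
      Category.assoc, Category.assoc]
  · intro h g
    rw [qtr_eq, comp_whiskerRight, Category.assoc]
    simpa using h _ (η_ Z Zᘁ ≫ g ▷ Zᘁ) (tev Z)

lemma IsNegligible.comp {X Y Z : C} {f : X ⟶ Y} (h : IsNegligible f) (g : Y ⟶ Z) :
    IsNegligible (f ≫ g) := by
  rw [isNegligible_iff] at h ⊢
  intro D u φ
  rw [comp_whiskerRight, Category.assoc, h]

lemma IsNegligible.precomp {X Y Z : C} {f : Y ⟶ Z} (h : IsNegligible f) (g : X ⟶ Y) :
    IsNegligible (g ≫ f) := by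
  rw [isNegligible_iff] at h ⊢
  intro D u φ
  rw [comp_whiskerRight, Category.assoc, ← Category.assoc, h]

lemma IsNegligible.whiskerRight {Y Z : C} {f : Y ⟶ Z} (h : IsNegligible f) (W : C) :
    IsNegligible (f ▷ W) := by
  rw [isNegligible_iff] at h ⊢
  intro D u φ
  have := h (W ⊗ D) (u ≫ (α_ _ _ _).hom) ((α_ _ _ _).inv ≫ φ)
  simpa using this

lemma IsNegligible.whiskerLeft {Y Z : C} {f : Y ⟶ Z} (h : IsNegligible f) (W : C) :
    IsNegligible (W ◁ f) := by
  have : W ◁ f = (β_ W Y).hom ≫ f ▷ W ≫ (β_ W Z).inv := by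
    rw [← BraidedCategory.braiding_naturality_right_assoc, Iso.hom_inv_id, Category.comp_id]
  rw [this]
  exact ((h.whiskerRight W).comp _).precomp _

variable (k : Type*) [Field k] [Linear k C] [MonoidalPreadditive C] [MonoidalLinear k C]

/-- The space of negligible morphisms. -/
def negl (X Y : C) : Submodule k (X ⟶ Y) where
  carrier := {f | IsNegligible f}
  zero_mem' g := by simp [qtr_eq, MonoidalPreadditive.zero_whiskerRight]
  add_mem' {a b} ha hb := by
    change IsNegligible a at ha
    change IsNegligible b at hb
    change IsNegligible _
    rw [isNegligible_iff] at *
    intro D u φ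
    rw [MonoidalPreadditive.add_whiskerRight, Preadditive.add_comp, Preadditive.comp_add, ha, hb,
      add_zero]
  smul_mem' c a ha := by
    change IsNegligible a at ha
    change IsNegligible _
    rw [isNegligible_iff] at *
    intro D u φ
    rw [MonoidalLinear.smul_whiskerRight, Linear.smul_comp, Linear.comp_smul, ha, smul_zero]

lemma mem_negl {X Y : C} {f : X ⟶ Y} : f ∈ negl k X Y ↔ IsNegligible f := Iff.rfl

end Ideal

/-- The purification of a ribbon category: the same objects, and morphisms modulo negligible
morphisms. -/
structure Purification (k C : Type*) where
  obj : C

namespace Purification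

variable {k : Type*} [Field k] {C : Type*} [Category C] [MonoidalCategory C] [BraidedCategory C]
  [RightRigidCategory C] [RibbonCategory C] [Preadditive C] [Linear k C] [MonoidalPreadditive C]
  [MonoidalLinear k C]

noncomputable instance : Category (Purification k C) where
  Hom X Y := (X.obj ⟶ Y.obj) ⧸ negl k X.obj Y.obj
  id X := Submodule.Quotient.mk (𝟙 X.obj)
  comp {X Y Z} f g := Quotient.map₂ (fun a b => a ≫ b) (fun a a' ha b b' hb => by
    rw [← Quotient.eq_iff_equiv] at *
    have ha' := (Submodule.Quotient.eq (negl k X.obj Y.obj)).1 ha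
    have hb' := (Submodule.Quotient.eq (negl k Y.obj Z.obj)).1 hb
    refine (Submodule.Quotient.eq (negl k X.obj Z.obj)).2 ?_
    have e : a ≫ b - a' ≫ b' = (a - a') ≫ b + a' ≫ (b - b') := by simp
    rw [e]
    exact add_mem (IsNegligible.comp ha' b) (IsNegligible.precomp hb' a')) f g
  id_comp := by rintro X Y ⟨f⟩; exact congrArg Submodule.Quotient.mk (Category.id_comp f)
  comp_id := by rintro X Y ⟨f⟩; exact congrArg Submodule.Quotient.mk (Category.comp_id f)
  assoc := by
    rintro W X Y Z ⟨f⟩ ⟨g⟩ ⟨h⟩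
    exact congrArg Submodule.Quotient.mk (Category.assoc f g h)

noncomputable instance (X Y : Purification k C) : AddCommGroup (X ⟶ Y) :=
  inferInstanceAs (AddCommGroup ((X.obj ⟶ Y.obj) ⧸ negl k X.obj Y.obj))
noncomputable instance (X Y : Purification k C) : Module k (X ⟶ Y) :=
  inferInstanceAs (Module k ((X.obj ⟶ Y.obj) ⧸ negl k X.obj Y.obj))

variable (k) in
/-- the class of a morphism -/
def cls {X Y : C} (f : X ⟶ Y) : (⟨X⟩ : Purification k C) ⟶ ⟨Y⟩ := Submodule.Quotient.mk f

lemma cls_surj {X Y : Purification k C} (f : X ⟶ Y) : ∃ g : X.obj ⟶ Y.obj, f = cls k g := by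
  obtain ⟨g⟩ := f
  exact ⟨g, rfl⟩

lemma cls_eq_iff {X Y : C} {f g : X ⟶ Y} : cls k f = cls k g ↔ IsNegligible (f - g) :=
  Submodule.Quotient.eq _

lemma cls_id (X : C) : cls k (𝟙 X) = 𝟙 _ := rfl
lemma cls_comp {X Y Z : C} (f : X ⟶ Y) (g : Y ⟶ Z) : cls k (f ≫ g) = cls k f ≫ cls k g := rfl
lemma cls_add {X Y : C} (f g : X ⟶ Y) : cls k (f + g) = cls k f + cls k g := rfl
lemma cls_zero {X Y : C} : cls k (0 : X ⟶ Y) = 0 := rfl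
lemma cls_smul {X Y : C} (c : k) (f : X ⟶ Y) : cls k (c • f) = c • cls k f := rfl

noncomputable instance : Preadditive (Purification k C) where
  add_comp := by
    rintro X Y Z ⟨f⟩ ⟨g⟩ ⟨h⟩
    exact congrArg (cls k) (Preadditive.add_comp _ _ _ f g h)
  comp_add := by
    rintro X Y Z ⟨f⟩ ⟨g⟩ ⟨h⟩
    exact congrArg (cls k) (Preadditive.comp_add _ _ _ f g h)

noncomputable instance : Linear k (Purification k C) where
  smul_comp := by
    rintro X Y Z c ⟨f⟩ ⟨g⟩
    exact congrArg (cls k) (Linear.smul_comp _ _ _ c f g)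
  comp_smul := by
    rintro X Y Z ⟨f⟩ c ⟨g⟩
    exact congrArg (cls k) (Linear.comp_smul _ _ _ f c g)

variable (k) in
/-- the class of an isomorphism -/
def clsIso {X Y : C} (e : X ≅ Y) : (⟨X⟩ : Purification k C) ≅ ⟨Y⟩ where
  hom := cls k e.hom
  inv := cls k e.inv
  hom_inv_id := congrArg (cls k) e.hom_inv_id
  inv_hom_id := congrArg (cls k) e.inv_hom_id

/-- `Z ◁ f` on classes -/
noncomputable def whiskerL (Z : Purification k C) {X Y : Purification k C} (f : X ⟶ Y) :
    (⟨Z.obj ⊗ X.obj⟩ : Purification k C) ⟶ ⟨Z.obj ⊗ Y.obj⟩ :=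
  Quotient.map (fun a => Z.obj ◁ a) (fun a b h => by
    rw [← Quotient.eq_iff_equiv] at *
    have h' := (Submodule.Quotient.eq (negl k X.obj Y.obj)).1 h
    refine (Submodule.Quotient.eq (negl k (Z.obj ⊗ X.obj) (Z.obj ⊗ Y.obj))).2 ?_
    have e : Z.obj ◁ a - Z.obj ◁ b = Z.obj ◁ (a - b) := by
      rw [sub_eq_add_neg, sub_eq_add_neg, MonoidalPreadditive.whiskerLeft_add]
      congr 1
      exact (((tensoringLeft C).obj Z.obj).map_neg).symm
    rw [e]
    exact IsNegligible.whiskerLeft h' _) f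

/-- `f ▷ Z` on classes -/
noncomputable def whiskerR {X Y : Purification k C} (f : X ⟶ Y) (Z : Purification k C) :
    (⟨X.obj ⊗ Z.obj⟩ : Purification k C) ⟶ ⟨Y.obj ⊗ Z.obj⟩ :=
  Quotient.map (fun a => a ▷ Z.obj) (fun a b h => by
    rw [← Quotient.eq_iff_equiv] at *
    have h' := (Submodule.Quotient.eq (negl k X.obj Y.obj)).1 h
    refine (Submodule.Quotient.eq (negl k (X.obj ⊗ Z.obj) (Y.obj ⊗ Z.obj))).2 ?_
    have e : a ▷ Z.obj - b ▷ Z.obj = (a - b) ▷ Z.obj := by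
      rw [sub_eq_add_neg, sub_eq_add_neg, MonoidalPreadditive.add_whiskerRight]
      congr 1
      exact (((tensoringRight C).obj Z.obj).map_neg).symm
    rw [e]
    exact IsNegligible.whiskerRight h' _) f

noncomputable instance : MonoidalCategoryStruct (Purification k C) where
  tensorObj X Y := ⟨X.obj ⊗ Y.obj⟩
  whiskerLeft Z _ _ f := whiskerL Z f
  whiskerRight f Z := whiskerR f Z
  tensorHom {_ Y X _} f g := whiskerR f X ≫ whiskerL Y g
  tensorUnit := ⟨𝟙_ C⟩
  associator X Y Z := clsIso k (α_ X.obj Y.obj Z.obj)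
  leftUnitor X := clsIso k (λ_ X.obj)
  rightUnitor X := clsIso k (ρ_ X.obj)

lemma cls_whiskerLeft (Z : C) {X Y : C} (f : X ⟶ Y) :
    cls k (Z ◁ f) = (⟨Z⟩ : Purification k C) ◁ cls k f := rfl
lemma cls_whiskerRight {X Y : C} (f : X ⟶ Y) (Z : C) :
    cls k (f ▷ Z) = cls k f ▷ (⟨Z⟩ : Purification k C) := rfl
lemma cls_tensorHom {X Y X' Y' : C} (f : X ⟶ Y) (g : X' ⟶ Y') :
    cls k (f ⊗ₘ g) = cls k f ⊗ₘ cls k g := by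
  rw [MonoidalCategory.tensorHom_def]; rfl

noncomputable instance : MonoidalCategory (Purification k C) where
  tensorHom_def _ _ := rfl
  id_tensorHom_id X Y := by
    change cls k (𝟙 X.obj) ⊗ₘ cls k (𝟙 Y.obj) = cls k (𝟙 (X.obj ⊗ Y.obj))
    rw [← cls_tensorHom, MonoidalCategory.id_tensorHom_id]
  tensorHom_comp_tensorHom := by
    intro X₁ Y₁ Z₁ X₂ Y₂ Z₂ f₁ f₂ g₁ g₂
    obtain ⟨f₁, rfl⟩ := cls_surj f₁
    obtain ⟨f₂, rfl⟩ := cls_surj f₂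
    obtain ⟨g₁, rfl⟩ := cls_surj g₁
    obtain ⟨g₂, rfl⟩ := cls_surj g₂
    rw [← cls_comp, ← cls_comp, ← cls_tensorHom, ← cls_tensorHom, ← cls_tensorHom,
      ← MonoidalCategory.tensorHom_comp_tensorHom]
    rfl
  whiskerLeft_id X Y := congrArg (cls k) (MonoidalCategory.whiskerLeft_id X.obj Y.obj)
  id_whiskerRight X Y := congrArg (cls k) (MonoidalCategory.id_whiskerRight X.obj Y.obj)
  associator_naturality := by
    intro X₁ X₂ X₃ Y₁ Y₂ Y₃ f₁ f₂ f₃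
    obtain ⟨f₁, rfl⟩ := cls_surj f₁
    obtain ⟨f₂, rfl⟩ := cls_surj f₂
    obtain ⟨f₃, rfl⟩ := cls_surj f₃
    have e := congrArg (cls k) (MonoidalCategory.associator_naturality f₁ f₂ f₃)
    rw [cls_comp, cls_comp, cls_tensorHom, cls_tensorHom, cls_tensorHom, cls_tensorHom] at e
    exact e
  leftUnitor_naturality := by
    rintro X Y ⟨f⟩
    exact congrArg (cls k) (MonoidalCategory.leftUnitor_naturality f)
  rightUnitor_naturality := by
    rintro X Y ⟨f⟩
    exact congrArg (cls k) (MonoidalCategory.rightUnitor_naturality f)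
  pentagon W X Y Z := congrArg (cls k) (MonoidalCategory.pentagon W.obj X.obj Y.obj Z.obj)
  triangle X Y := congrArg (cls k) (MonoidalCategory.triangle X.obj Y.obj)

instance : MonoidalPreadditive (Purification k C) where
  whiskerLeft_zero := congrArg (cls k) MonoidalPreadditive.whiskerLeft_zero
  zero_whiskerRight := congrArg (cls k) MonoidalPreadditive.zero_whiskerRight
  whiskerLeft_add := by
    rintro X Y Z ⟨f⟩ ⟨g⟩
    exact congrArg (cls k) (MonoidalPreadditive.whiskerLeft_add f g)
  add_whiskerRight := by
    rintro X Y Z ⟨f⟩ ⟨g⟩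
    exact congrArg (cls k) (MonoidalPreadditive.add_whiskerRight f g)

instance : MonoidalLinear k (Purification k C) where
  whiskerLeft_smul := by
    rintro X Y Z c ⟨f⟩
    exact congrArg (cls k) (MonoidalLinear.whiskerLeft_smul X.obj c f)
  smul_whiskerRight := by
    rintro c Y Z ⟨f⟩ X
    exact congrArg (cls k) (MonoidalLinear.smul_whiskerRight c f X.obj)

noncomputable instance : BraidedCategory (Purification k C) where
  braiding X Y := clsIso k (β_ X.obj Y.obj)
  braiding_naturality_right := by
    rintro X Y Z ⟨f⟩
    exact congrArg (cls k) (BraidedCategory.braiding_naturality_right X.obj f)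
  braiding_naturality_left := by
    rintro X Y ⟨f⟩ Z
    exact congrArg (cls k) (BraidedCategory.braiding_naturality_left f Z.obj)
  hexagon_forward X Y Z :=
    congrArg (cls k) (BraidedCategory.hexagon_forward X.obj Y.obj Z.obj)
  hexagon_reverse X Y Z :=
    congrArg (cls k) (BraidedCategory.hexagon_reverse X.obj Y.obj Z.obj)

noncomputable instance : RightRigidCategory (Purification k C) where
  rightDual X :=
    { rightDual := ⟨X.objᘁ⟩
      exact :=
        { coevaluation' := cls k (η_ X.obj X.objᘁ)
          evaluation' := cls k (ε_ X.obj X.objᘁ)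
          coevaluation_evaluation' :=
            congrArg (cls k) (ExactPairing.coevaluation_evaluation X.obj X.objᘁ)
          evaluation_coevaluation' :=
            congrArg (cls k) (ExactPairing.evaluation_coevaluation X.obj X.objᘁ) } }

noncomputable instance : RibbonCategory (Purification k C) where
  twist X := clsIso k (twist X.obj)
  twist_naturality := by
    rintro X Y ⟨f⟩
    exact congrArg (cls k) (twist_naturality f)
  twist_tensor X Y := by
    refine (congrArg (cls k) (twist_tensor X.obj Y.obj)).trans ?_
    rw [cls_comp, cls_tensorHom]; rfl
  twist_dual X := congrArg (cls k) (twist_dual X.obj)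

end Purification
end Purification

section FullSubcategory

open RibbonCategory

variable {C : Type*} [Category C] [MonoidalCategory C] [RightRigidCategory C]

/-- A class of objects closed under duals. -/
class ClosedUnderDual (P : ObjectProperty C) : Prop where
  prop_dual (X : C) : P X → P Xᘁ

variable (P : ObjectProperty C) [P.IsMonoidal] [ClosedUnderDual P]

/-- A full monoidal subcategory closed under duals inherits the duality. -/
noncomputable instance : RightRigidCategory P.FullSubcategory where
  rightDual X :=
    { rightDual := ⟨X.objᘁ, ClosedUnderDual.prop_dual _ X.property⟩
      exact :=
        { coevaluation' := ObjectProperty.homMk (η_ X.obj X.objᘁ)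
          evaluation' := ObjectProperty.homMk (ε_ X.obj X.objᘁ)
          coevaluation_evaluation' := ObjectProperty.hom_ext _
            (ExactPairing.coevaluation_evaluation X.obj X.objᘁ)
          evaluation_coevaluation' := ObjectProperty.hom_ext _
            (ExactPairing.evaluation_coevaluation X.obj X.objᘁ) } }

variable [BraidedCategory C] [RibbonCategory C]

/-- A full monoidal subcategory closed under duals inherits the twist. -/
noncomputable instance : RibbonCategory P.FullSubcategory where
  twist X := P.isoMk (twist X.obj)
  twist_naturality f := ObjectProperty.hom_ext _ (twist_naturality f.hom)
  twist_tensor X Y := ObjectProperty.hom_ext _ (twist_tensor X.obj Y.obj)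
  twist_dual X := ObjectProperty.hom_ext _ (twist_dual X.obj)

end FullSubcategory

section Modular

variable (k : Type u) {H : Type u} [Field k] [Ring H] [Algebra k H] [RibbonQuantumGroupoid k H]
  {I : Type*} [Fintype I] [DecidableEq I]

/-- `(H, R, ν, V)` is a modular quantum groupoid. -/
structure IsModularQuantumGroupoid (V : I → QGRep k H) : Prop extends IsModularFamily k V where
  /-- `V_a ⊗ V_b` is a finite direct sum of members of the family and a negligible module. -/
  tensor : ∀ a b, ∃ (n : ℕ) (s : Fin n → I) (N : QGRep k H), IsNegligibleObj N ∧
    Nonempty ((V a ⊗ V b).carrier ≃ₗ[H] ((r : Fin n) → (V (s r)).carrier) × N.carrier)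

variable {k}

/-- The modules quasidominated by the family `V`. -/
def quasidominated {I : Type*} (V : I → QGRep k H) : ObjectProperty (QGRep k H) :=
  fun X => Quasidominates V X

lemma quasidominated_self {I : Type*} (V : I → QGRep k H) (i : I) : quasidominated V (V i) :=
  ⟨1, fun _ => i, fun _ => 𝟙 _, fun _ => 𝟙 _, fun g => by
    simp [qtr_eq, MonoidalPreadditive.zero_whiskerRight]⟩

/-- The family `V` inside the full subcategory of the modules which it quasidominates. -/
def quasidominatedFamily {I : Type*} (V : I → QGRep k H) (i : I) :
    (quasidominated V).FullSubcategory := ⟨V i, quasidominated_self V i⟩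

end Modular

/-!
A family quasidominates an object exactly when it dominates it in the purification, and domination
is transitive and compatible with tensor products and duals, because `𝟙 X = ∑ r, g r ≫ f r` can be
tensored, dualised and refined term by term. Hence `𝒞` is closed under `⊗` and `*` as soon as it
contains the `V_a ⊗ V_b` and the `V_i*`.

The direct sum decompositions come from the cyclicity of the trace. If every composite
`V_i ⟶ X ⟶ V_i` vanishes, then so does the trace of every endomorphism of `X` which factors through
`V_i`, so that a quasidominated `X` is negligible. Otherwise some composite is a nonzero scalar, and
`V_i` splits off `X`; the complement, a retract of `X`, is again quasidominated and has smaller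
dimension.

No `V_i` is negligible, since negligible objects form a tensor ideal and a negligible `V_i` would
give a zero row of the invertible matrix `S`. So the `V_i` stay simple in the purification.
-/

section Domination

variable {C : Type*} [Category C] [Preadditive C] {I J : Type*} {V : I → C} {W : J → C} {X Y : C}

lemma Dominates.of_sum {ι : Type*} [Fintype ι] (s : ι → I) (f : ∀ r, V (s r) ⟶ X)
    (g : ∀ r, X ⟶ V (s r)) (h : 𝟙 X = ∑ r, g r ≫ f r) : Dominates V X := by
  let e := (Fintype.equivFin ι).symm
  refine ⟨Fintype.card ι, fun r => s (e r), fun r => f (e r), fun r => g (e r), ?_⟩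
  rw [h, e.sum_comp fun r => g r ≫ f r]

lemma Dominates.trans (hX : Dominates W X) (hW : ∀ j, Dominates V (W j)) : Dominates V X := by
  obtain ⟨m, t, f, g, hfg⟩ := hX
  choose n s a b hab using hW
  refine Dominates.of_sum (ι := Σ r : Fin m, Fin (n (t r))) (fun p => s (t p.1) p.2)
    (fun p => a (t p.1) p.2 ≫ f p.1) (fun p => g p.1 ≫ b (t p.1) p.2) ?_
  calc 𝟙 X = ∑ r, g r ≫ 𝟙 (W (t r)) ≫ f r := by simpa only [Category.id_comp] using hfg
    _ = ∑ r, ∑ q, (g r ≫ b (t r) q) ≫ a (t r) q ≫ f r := by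
      simp only [hab, Preadditive.sum_comp, Preadditive.comp_sum, Category.assoc]
    _ = ∑ p : Σ r : Fin m, Fin (n (t r)), (g p.1 ≫ b (t p.1) p.2) ≫ a (t p.1) p.2 ≫ f p.1 := by
      rw [Fintype.sum_sigma]

variable [MonoidalCategory C] [MonoidalPreadditive C]

lemma Dominates.tensor (hX : Dominates V X) (hY : Dominates W Y) :
    Dominates (fun p : I × J => V p.1 ⊗ W p.2) (X ⊗ Y) := by
  obtain ⟨m, s, f, g, hfg⟩ := hX
  obtain ⟨n, t, a, b, hab⟩ := hY
  refine Dominates.of_sum (ι := Fin m × Fin n) (fun p => (s p.1, t p.2))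
    (fun p => f p.1 ⊗ₘ a p.2) (fun p => g p.1 ⊗ₘ b p.2) ?_
  calc 𝟙 (X ⊗ Y) = 𝟙 X ⊗ₘ 𝟙 Y := (id_tensorHom_id X Y).symm
    _ = ∑ r, ∑ q, (g r ≫ f r) ⊗ₘ (b q ≫ a q) := by
      rw [hfg, hab, sum_tensor]
      simp only [tensor_sum]
    _ = ∑ p : Fin m × Fin n, (g p.1 ⊗ₘ b p.2) ≫ (f p.1 ⊗ₘ a p.2) := by
      rw [Fintype.sum_prod_type]
      simp only [tensorHom_comp_tensorHom]

lemma rightAdjointMate_sum [HasRightDual X] [HasRightDual Y] {ι : Type*} (s : Finset ι)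
    (f : ι → (X ⟶ Y)) : (∑ r ∈ s, f r)ᘁ = ∑ r ∈ s, (f r)ᘁ := by
  simp only [rightAdjointMate, whiskerLeft_sum, sum_whiskerRight, Preadditive.comp_sum,
    Preadditive.sum_comp]

lemma Dominates.rightDual [RightRigidCategory C] (hX : Dominates V X) :
    Dominates (fun i => (V i)ᘁ) Xᘁ := by
  obtain ⟨n, s, f, g, hfg⟩ := hX
  refine ⟨n, s, fun r => (g r)ᘁ, fun r => (f r)ᘁ, ?_⟩
  rw [← rightAdjointMate_id, hfg, rightAdjointMate_sum]
  simp only [comp_rightAdjointMate]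

end Domination

section QuantumTrace

variable {C : Type*} [Category C] [MonoidalCategory C] [BraidedCategory C]
  [RightRigidCategory C] [RibbonCategory C] {X Y : C}

lemma whiskerLeft_rightAdjointMate_tev (g : Y ⟶ X) : Y ◁ gᘁ ≫ tev Y = g ▷ Xᘁ ≫ tev X := by
  rw [tev, tev, whisker_exchange_assoc, BraidedCategory.braiding_naturality_right_assoc,
    rightAdjointMate_comp_evaluation, ← BraidedCategory.braiding_naturality_left_assoc,
    ← comp_whiskerRight_assoc, ← comp_whiskerRight_assoc, RibbonCategory.twist_naturality]

lemma qtr_comp_comm (f : X ⟶ Y) (g : Y ⟶ X) : qtr (g ≫ f) = qtr (f ≫ g) := by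
  rw [qtr_eq, qtr_eq, comp_whiskerRight_assoc, ← coevaluation_comp_rightAdjointMate_assoc,
    whisker_exchange_assoc, whiskerLeft_rightAdjointMate_tev, comp_whiskerRight_assoc]

variable [Preadditive C]

lemma qtr_zero [MonoidalPreadditive C] : qtr (0 : X ⟶ X) = 0 := by
  rw [qtr_eq, MonoidalPreadditive.zero_whiskerRight, Limits.zero_comp, Limits.comp_zero]

lemma isNegligible_id_iff : IsNegligible (𝟙 X) ↔ IsNegligibleObj X :=
  forall_congr' fun f => by rw [Category.comp_id]

lemma IsNegligibleObj.tensor_left (hX : IsNegligibleObj X) (Y : C) : IsNegligibleObj (Y ⊗ X) := by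
  rw [← isNegligible_id_iff] at hX ⊢
  rw [← whiskerLeft_id]
  exact hX.whiskerLeft Y

lemma Quasidominates.of_retract {I : Type*} {V : I → C} (hY : Quasidominates V Y)
    (r : Retract X Y) : Quasidominates V X := by
  obtain ⟨n, s, f, g, hfg⟩ := hY
  refine ⟨n, s, fun q => f q ≫ r.r, fun q => r.i ≫ g q, ?_⟩
  have hretract : 𝟙 X - ∑ q, (r.i ≫ g q) ≫ f q ≫ r.r =
      r.i ≫ (𝟙 Y - ∑ q, g q ≫ f q) ≫ r.r := by
    simp only [Preadditive.sub_comp, Preadditive.comp_sub, Preadditive.sum_comp,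
      Preadditive.comp_sum, Category.id_comp, Category.assoc, r.retract]
  rw [hretract]
  exact (hfg.comp r.r).precomp r.i

end QuantumTrace

section SimpleObjects

variable {k : Type*} [Field k] {C : Type*} [Category C] [Preadditive C] [Linear k C] {S X : C}

lemma IsSimpleObj.nonempty_retract (hS : IsSimpleObj k S) (a : S ⟶ X) (b : X ⟶ S)
    (hab : a ≫ b ≠ 0) : Nonempty (Retract S X) := by
  obtain ⟨c, hc : c • 𝟙 S = a ≫ b⟩ := hS.2 (a ≫ b)
  have hc0 : c ≠ 0 := by
    rintro rfl
    exact hab (by rw [← hc, zero_smul])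
  exact ⟨⟨a, c⁻¹ • b, by rw [Linear.comp_smul, ← hc, inv_smul_smul₀ hc0]⟩⟩

lemma IsSimpleObj.id_ne_zero (hS : IsSimpleObj k S) : 𝟙 S ≠ 0 := fun h =>
  one_ne_zero (hS.1 (by simp only [h, smul_zero]) : (1 : k) = 0)

variable [MonoidalCategory C] [MonoidalPreadditive C] [MonoidalLinear k C] [BraidedCategory C]
  [RightRigidCategory C] [RibbonCategory C]

lemma Quasidominates.exists_retract {I : Type*} {V : I → C} (hV : ∀ i, IsSimpleObj k (V i))
    (hX : Quasidominates V X) (hN : ¬ IsNegligibleObj X) :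
    ∃ i, Nonempty (Retract (V i) X) := by
  by_contra! hr
  have hcomp (i : I) (a : V i ⟶ X) (b : X ⟶ V i) : a ≫ b = 0 := by
    by_contra hab
    exact not_isEmpty_iff.2 ((hV i).nonempty_retract a b hab) (hr i)
  have hfactor (i : I) (f : V i ⟶ X) (g : X ⟶ V i) : IsNegligible (g ≫ f) := fun c => by
    rw [← Category.assoc, qtr_comp_comm, hcomp, qtr_zero]
  obtain ⟨n, s, f, g, hfg⟩ := hX
  have hsum := (negl k X X).add_mem ((mem_negl k).2 hfg)
    (Submodule.sum_mem _ fun r (_ : r ∈ Finset.univ) => (mem_negl k).2 (hfactor (s r) (f r) (g r)))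
  rw [sub_add_cancel] at hsum
  exact hN (isNegligible_id_iff.1 hsum)

end SimpleObjects

section Purification

variable (k : Type*) [Field k] {C : Type*} [Category C] [MonoidalCategory C] [BraidedCategory C]
  [RightRigidCategory C] [RibbonCategory C] [Preadditive C] [Linear k C] [MonoidalPreadditive C]
  [MonoidalLinear k C] {I J : Type*} {V : I → C} {W : J → C} {X Y : C}

lemma Purification.cls_sum {ι : Type*} (s : Finset ι) (f : ι → (X ⟶ Y)) :
    cls k (∑ r ∈ s, f r) = ∑ r ∈ s, cls k (f r) :=
  map_sum (negl k X Y).mkQ f s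

lemma quasidominates_iff_dominates_purification :
    Quasidominates V X ↔ Dominates (fun i => (⟨V i⟩ : Purification k C)) ⟨X⟩ := by
  have hcls {n : ℕ} {s : Fin n → I} (f : ∀ r, V (s r) ⟶ X) (g : ∀ r, X ⟶ V (s r)) :
      IsNegligible (𝟙 X - ∑ r, g r ≫ f r) ↔
        𝟙 (⟨X⟩ : Purification k C) =
          ∑ r, Purification.cls k (g r) ≫ Purification.cls k (f r) := by
    rw [← Purification.cls_eq_iff (k := k), Purification.cls_sum]
    rfl
  constructor
  · rintro ⟨n, s, f, g, hfg⟩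
    exact ⟨n, s, fun r => Purification.cls k (f r), fun r => Purification.cls k (g r),
      (hcls f g).1 hfg⟩
  · rintro ⟨n, s, f, g, hfg⟩
    choose f' hf' using fun r => Purification.cls_surj (f r)
    choose g' hg' using fun r => Purification.cls_surj (g r)
    refine ⟨n, s, f', g', (hcls f' g').2 ?_⟩
    simpa only [hf', hg'] using hfg

include k in
lemma Quasidominates.trans (hX : Quasidominates W X) (hW : ∀ j, Quasidominates V (W j)) :
    Quasidominates V X := by
  simp only [quasidominates_iff_dominates_purification k] at hX hW ⊢
  exact hX.trans hW

include k in
lemma Quasidominates.tensor (hX : Quasidominates V X) (hY : Quasidominates W Y) :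
    Quasidominates (fun p : I × J => V p.1 ⊗ W p.2) (X ⊗ Y) := by
  rw [quasidominates_iff_dominates_purification k] at hX hY ⊢
  exact hX.tensor hY

include k in
lemma Quasidominates.rightDual (hX : Quasidominates V X) :
    Quasidominates (fun i => (V i)ᘁ) Xᘁ := by
  rw [quasidominates_iff_dominates_purification k] at hX ⊢
  exact hX.rightDual

variable {k}

lemma IsSimpleObj.purification (hX : IsSimpleObj k X) (hN : ¬ IsNegligibleObj X) :
    IsSimpleObj k (⟨X⟩ : Purification k C) := by
  refine ⟨fun c d hcd => ?_, fun f => ?_⟩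
  · by_contra hne
    have hnegl : (c - d) • 𝟙 X ∈ negl k X X := by
      rw [sub_smul]
      exact Purification.cls_eq_iff.1 hcd
    rw [Submodule.smul_mem_iff _ (sub_ne_zero.2 hne)] at hnegl
    exact hN (isNegligible_id_iff.1 hnegl)
  · obtain ⟨g, rfl⟩ := Purification.cls_surj f
    obtain ⟨c, rfl⟩ := hX.2 g
    exact ⟨c, rfl⟩

end Purification

section ModularFamilies

variable {k : Type*} [Field k] {C : Type*} [Category C] [MonoidalCategory C] [BraidedCategory C]
  [RightRigidCategory C] [RibbonCategory C] [Preadditive C] [Linear k C]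
  {I : Type*} [Fintype I] [DecidableEq I] {V : I → C}

lemma IsModularFamily.isSimpleObj_unit (h : IsModularFamily k V) : IsSimpleObj k (𝟙_ C) := by
  obtain ⟨o, ho⟩ := h.unit
  exact ho ▸ h.simple o

lemma IsModularFamily.not_isNegligibleObj (h : IsModularFamily k V) (i : I) :
    ¬ IsNegligibleObj (V i) := by
  intro hi
  obtain ⟨S, hS, hu⟩ := h.smatrix
  have hrow : S i = 0 := funext fun j => by
    have hij : S i j • 𝟙 (𝟙_ C) = 0 := (hS i j).trans (hi.tensor_left (V j) _)
    exact (smul_eq_zero.1 hij).resolve_right h.isSimpleObj_unit.id_ne_zero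
  exact (Matrix.isUnit_iff_isUnit_det S).1 hu |>.ne_zero
    (Matrix.det_eq_zero_of_row_eq_zero i (congrFun hrow))

variable [MonoidalPreadditive C] [MonoidalLinear k C]

lemma IsModularFamily.purification (h : IsModularFamily k V) :
    IsModularFamily k (fun i => (⟨V i⟩ : Purification k C)) where
  simple i := (h.simple i).purification (h.not_isNegligibleObj i)
  unit := h.unit.imp fun _ => congrArg Purification.mk
  dual i := (h.dual i).imp fun _ => Nonempty.map (Purification.clsIso k)
  smatrix := by
    obtain ⟨S, hS, hu⟩ := h.smatrix
    exact ⟨S, fun i j => congrArg (Purification.cls k) (hS i j), hu⟩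

theorem IsQuasimodular.purification (h : IsQuasimodular k V) :
    IsModular k (fun i => (⟨V i⟩ : Purification k C)) where
  toIsModularFamily := h.toIsModularFamily.purification
  dominates X := (quasidominates_iff_dominates_purification k).1 (h.quasidominates X.obj)

end ModularFamilies

section FullSubcategories

variable {k : Type*} [Field k] {C : Type*} [Category C] [MonoidalCategory C] [BraidedCategory C]
  [RightRigidCategory C] [RibbonCategory C] [Preadditive C]
  {P : ObjectProperty C} [P.IsMonoidal] [ClosedUnderDual P] {I : Type*} {V : I → P.FullSubcategory}

lemma isNegligible_fullSubcategory_iff {X Y : P.FullSubcategory} (f : X ⟶ Y) :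
    IsNegligible f ↔ IsNegligible f.hom :=
  ⟨fun h g => congrArg (fun t => t.hom) (h (ObjectProperty.homMk g)),
    fun h g => ObjectProperty.hom_ext _ (h g.hom)⟩

lemma quasidominates_fullSubcategory_iff {X : P.FullSubcategory} :
    Quasidominates V X ↔ Quasidominates (fun i => (V i).obj) X.obj := by
  have hhom {n : ℕ} {s : Fin n → I} (f : ∀ r, V (s r) ⟶ X) (g : ∀ r, X ⟶ V (s r)) :
      IsNegligible (𝟙 X - ∑ r, g r ≫ f r) ↔
        IsNegligible (𝟙 X.obj - ∑ r, (g r).hom ≫ (f r).hom) := by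
    rw [isNegligible_fullSubcategory_iff, ← ObjectProperty.ι_map, Functor.map_sub, Functor.map_sum]
    rfl
  constructor
  · rintro ⟨n, s, f, g, hfg⟩
    exact ⟨n, s, fun r => (f r).hom, fun r => (g r).hom, (hhom f g).1 hfg⟩
  · rintro ⟨n, s, f, g, hfg⟩
    exact ⟨n, s, fun r => ObjectProperty.homMk (f r), fun r => ObjectProperty.homMk (g r),
      (hhom _ _).2 hfg⟩

variable [Linear k C]

omit [MonoidalCategory C] [BraidedCategory C] [RightRigidCategory C] [RibbonCategory C]
  [P.IsMonoidal] [ClosedUnderDual P] in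
lemma isSimpleObj_fullSubcategory_iff {X : P.FullSubcategory} :
    IsSimpleObj k X ↔ IsSimpleObj k X.obj :=
  (Equiv.bijective (P.fullyFaithfulι.homEquiv (X := X) (Y := X))).of_comp_iff' _ |>.symm

variable [Fintype I] [DecidableEq I]

lemma isModularFamily_fullSubcategory_iff :
    IsModularFamily k V ↔ IsModularFamily k (fun i => (V i).obj) := by
  have hunit (i : I) : V i = 𝟙_ P.FullSubcategory ↔ (V i).obj = 𝟙_ C :=
    ⟨congrArg ObjectProperty.FullSubcategory.obj, fun h => ObjectProperty.FullSubcategory.ext h⟩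
  have hdual (i j : I) : Nonempty (V j ≅ (V i)ᘁ) ↔ Nonempty ((V j).obj ≅ (V i).objᘁ) :=
    P.fullyFaithfulι.isoEquiv.nonempty_congr
  have hS (c : k) (i j : I) :
      c • 𝟙 (𝟙_ P.FullSubcategory) = qtr ((β_ (V j) (V i)).hom ≫ (β_ (V i) (V j)).hom) ↔
        c • 𝟙 (𝟙_ C) =
          qtr ((β_ (V j).obj (V i).obj).hom ≫ (β_ (V i).obj (V j).obj).hom) :=
    P.fullyFaithfulι.homEquiv.injective.eq_iff.symm
  constructor
  · rintro ⟨hsimple, hu, hd, hs⟩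
    simp only [isSimpleObj_fullSubcategory_iff, hunit, hdual, hS] at hsimple hu hd hs
    exact ⟨hsimple, hu, hd, hs⟩
  · rintro ⟨hsimple, hu, hd, hs⟩
    simp only [← isSimpleObj_fullSubcategory_iff, ← hunit, ← hdual, ← hS] at hsimple hu hd hs
    exact ⟨hsimple, hu, hd, hs⟩

lemma isQuasimodular_fullSubcategory_iff [MonoidalPreadditive C] [MonoidalLinear k C] :
    IsQuasimodular k V ↔ IsModularFamily k (fun i => (V i).obj) ∧
      ∀ X, P X → Quasidominates (fun i => (V i).obj) X := by
  rw [← isModularFamily_fullSubcategory_iff]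
  exact ⟨fun h => ⟨h.toIsModularFamily, fun X hX =>
      quasidominates_fullSubcategory_iff.1 (h.quasidominates ⟨X, hX⟩)⟩,
    fun h => ⟨h.1, fun X => quasidominates_fullSubcategory_iff.2 (h.2 X.obj X.property)⟩⟩

end FullSubcategories

section DirectSums

namespace QGRep

variable {k H : Type u} [Field k] [Ring H] [Algebra k H] {S X Y K : QGRep k H}

lemma sum_lin {ι : Type*} (s : Finset ι) (f : ι → (X ⟶ Y)) (x : X.carrier) :
    (∑ r ∈ s, f r).lin x = ∑ r ∈ s, (f r).lin x :=
  map_sum (AddMonoidHom.mk' (fun f : X ⟶ Y => f.lin x) fun _ _ => rfl) f s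

lemma exists_equiv_prod_of_retract (r : Retract S X) :
    ∃ K : QGRep k H, Nonempty (X.carrier ≃ₗ[H] S.carrier × K.carrier) := by
  have hsplit : r.r.lin ∘ₗ r.i.lin = LinearMap.id := congrArg Hom.lin r.retract
  let K : QGRep k H :=
    { carrier := LinearMap.ker r.r.lin
      finite := Module.Finite.of_injective ((LinearMap.ker r.r.lin).subtype.restrictScalars k)
        Subtype.val_injective }
  obtain ⟨e, -⟩ := (LinearMap.exact_subtype_ker_map r.r.lin).splitSurjectiveEquiv
    Subtype.val_injective ⟨r.i.lin, hsplit⟩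
  exact ⟨K, ⟨e ≪≫ₗ LinearEquiv.prodComm H _ _⟩⟩

lemma nonempty_retract_of_equiv_prod {M : Type*} [AddCommGroup M] [Module H M]
    (e : X.carrier ≃ₗ[H] M × K.carrier) : Nonempty (Retract K X) :=
  ⟨{  i := ⟨e.symm.toLinearMap ∘ₗ LinearMap.inr H _ _⟩
      r := ⟨LinearMap.snd H _ _ ∘ₗ e.toLinearMap⟩
      retract := hom_ext fun x => by simp }⟩

lemma nontrivial_of_isSimpleObj (hX : IsSimpleObj k X) : Nontrivial X.carrier := by
  by_contra hX'
  rw [not_nontrivial_iff_subsingleton] at hX'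
  exact hX.id_ne_zero (hom_ext fun _ => Subsingleton.elim _ _)

lemma finrank_lt_of_equiv_prod [Nontrivial S.carrier]
    (e : X.carrier ≃ₗ[H] S.carrier × K.carrier) :
    Module.finrank k K.carrier < Module.finrank k X.carrier := by
  rw [(e.restrictScalars k).finrank_eq, Module.finrank_prod]
  exact Nat.lt_add_of_pos_left Module.finrank_pos

variable [RibbonQuantumGroupoid k H] {I : Type*} {V : I → QGRep k H}

lemma quasidominates_of_equiv_prod {n : ℕ} {s : Fin n → I} {N : QGRep k H}
    (hN : IsNegligibleObj N)
    (e : X.carrier ≃ₗ[H] ((r : Fin n) → (V (s r)).carrier) × N.carrier) :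
    Quasidominates V X := by
  let f (r : Fin n) : V (s r) ⟶ X := ⟨e.symm.toLinearMap ∘ₗ LinearMap.inl H _ _ ∘ₗ
    LinearMap.single H (fun r => (V (s r)).carrier) r⟩
  let g (r : Fin n) : X ⟶ V (s r) := ⟨LinearMap.proj r ∘ₗ LinearMap.fst H _ _ ∘ₗ e.toLinearMap⟩
  let p : X ⟶ N := ⟨LinearMap.snd H _ _ ∘ₗ e.toLinearMap⟩
  let q : N ⟶ X := ⟨e.symm.toLinearMap ∘ₗ LinearMap.inr H _ _⟩
  have hid : 𝟙 X = (∑ r, g r ≫ f r) + p ≫ 𝟙 N ≫ q := by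
    refine hom_ext fun x => e.injective ?_
    rw [add_lin, sum_lin, map_add, map_sum]
    simp only [comp_lin, id_lin, f, g, p, q, LinearMap.comp_apply, LinearEquiv.coe_coe,
      LinearEquiv.apply_symm_apply]
    ext1
    · simpa [Prod.fst_sum] using (Finset.univ_sum_single (e x).1).symm
    · simp [Prod.snd_sum]
  refine ⟨n, s, f, g, ?_⟩
  rw [sub_eq_of_eq_add' hid]
  exact ((isNegligible_id_iff.2 hN).comp q).precomp p

lemma exists_equiv_prod_of_quasidominates (hV : ∀ i, IsSimpleObj k (V i))
    (hX : Quasidominates V X) :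
    ∃ (n : ℕ) (s : Fin n → I) (N : QGRep k H), IsNegligibleObj N ∧
      Nonempty (X.carrier ≃ₗ[H] ((r : Fin n) → (V (s r)).carrier) × N.carrier) := by
  induction hd : Module.finrank k X.carrier using Nat.strong_induction_on generalizing X with
  | _ d ih =>
  by_cases hN : IsNegligibleObj X
  · exact ⟨0, Fin.elim0, X, hN, ⟨(LinearEquiv.uniqueProd (R := H)).symm⟩⟩
  obtain ⟨i, ⟨r⟩⟩ := hX.exists_retract hV hN
  obtain ⟨K, ⟨e⟩⟩ := exists_equiv_prod_of_retract r
  obtain ⟨r'⟩ := nonempty_retract_of_equiv_prod e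
  have := nontrivial_of_isSimpleObj (hV i)
  obtain ⟨n, s, N, hN', ⟨e'⟩⟩ :=
    ih _ (hd ▸ finrank_lt_of_equiv_prod e) (hX.of_retract r') rfl
  refine ⟨n + 1, Fin.cons i s, N, hN', ⟨?_⟩⟩
  exact e ≪≫ₗ (LinearEquiv.refl H _).prodCongr e' ≪≫ₗ (LinearEquiv.prodAssoc H _ _ _).symm ≪≫ₗ
    (Fin.consLinearEquiv H fun r => (V ((Fin.cons i s : Fin (n + 1) → I) r)).carrier).prodCongr
      (LinearEquiv.refl H _)

end QGRep

end DirectSums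

section ModularQuantumGroupoids

variable {k H : Type u} [Field k] [Ring H] [Algebra k H] [RibbonQuantumGroupoid k H]
  {I : Type*} [Fintype I] [DecidableEq I] {V : I → QGRep k H}

lemma isModularQuantumGroupoid_iff : IsModularQuantumGroupoid k V ↔
    IsModularFamily k V ∧ ∀ a b, Quasidominates V (V a ⊗ V b) := by
  refine ⟨fun h => ⟨h.toIsModularFamily, fun a b => ?_⟩, fun ⟨h, htensor⟩ => ⟨h, fun a b =>
    QGRep.exists_equiv_prod_of_quasidominates h.simple (htensor a b)⟩⟩
  obtain ⟨n, s, N, hN, ⟨e⟩⟩ := h.tensor a b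
  exact QGRep.quasidominates_of_equiv_prod hN e

lemma IsModularFamily.isMonoidal_quasidominated (h : IsModularFamily k V)
    (htensor : ∀ a b, Quasidominates V (V a ⊗ V b)) : (quasidominated V).IsMonoidal where
  prop_unit := by
    obtain ⟨o, ho⟩ := h.unit
    exact ho ▸ quasidominated_self V o
  prop_tensor _ _ hX hY := (Quasidominates.tensor k hX hY).trans k fun p => htensor p.1 p.2

lemma IsModularFamily.closedUnderDual_quasidominated (h : IsModularFamily k V) :
    ClosedUnderDual (quasidominated V) where
  prop_dual _ hX := (Quasidominates.rightDual k hX).trans k fun i => by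
    obtain ⟨j, ⟨e⟩⟩ := h.dual i
    exact (quasidominated_self V j).of_retract e.symm.retract

lemma isQuasimodular_quasidominatedFamily_iff [(quasidominated V).IsMonoidal]
    [ClosedUnderDual (quasidominated V)] :
    IsQuasimodular k (quasidominatedFamily V) ↔ IsModularFamily k V :=
  isQuasimodular_fullSubcategory_iff.trans (and_iff_left fun _ hX => hX)

end ModularQuantumGroupoids

theorem mainTheorem12 {k H : Type u} [Field k] [Ring H] [Algebra k H] [RibbonQuantumGroupoid k H]
    {I : Type*} [Fintype I] [DecidableEq I] (V : I → QGRep k H) :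
    (IsModularQuantumGroupoid k V ↔
      ∃ (_ : (quasidominated V).IsMonoidal) (_ : ClosedUnderDual (quasidominated V)),
        IsQuasimodular k (quasidominatedFamily V)) ∧
    (∀ (_ : (quasidominated V).IsMonoidal) (_ : ClosedUnderDual (quasidominated V)),
      IsQuasimodular k (quasidominatedFamily V) →
        IsModular k (fun i => (⟨quasidominatedFamily V i⟩ :
          Purification k (quasidominated V).FullSubcategory))) := by
  refine ⟨?_, fun _ _ h => h.purification⟩
  rw [isModularQuantumGroupoid_iff]
  constructor
  · rintro ⟨hV, htensor⟩
    have hmonoidal := hV.isMonoidal_quasidominated htensor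
    have hdual := hV.closedUnderDual_quasidominated
    exact ⟨hmonoidal, hdual, isQuasimodular_quasidominatedFamily_iff.2 hV⟩
  · rintro ⟨_, _, h⟩
    exact ⟨isQuasimodular_quasidominatedFamily_iff.1 h, fun a b =>
      ObjectProperty.prop_tensor (Q := quasidominated V) (quasidominated_self V a)
        (quasidominated_self V b)⟩
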